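/- **Setting.** Let $n\ge 1$, write $[k]=\{0,\dots,k-1\}$, and let $\gamma_0<\gamma_1<\dots<\gamma_{n-1}$ be real numbers. An *IV model* (binary treatment, binary instrument) consists of random variables on a probability space: potential outcomes $Y^{(d,z)}$ with values in $\{\gamma_0,\dots,\gamma_{n-1}\}$ almost surely ($d,z\in\{0,1\}$), potential treatments $D^{(0)},D^{(1)}\in\{0,1\}$, an instrument $Z\in\{0,1\}$ with $\Pr(Z=0),\Pr(Z=1)>0$, an observed treatment $D\in\{0,1\}$ and an observed outcome $Y$, such that * (individual-level exclusion) $Y^{(d,0)}=Y^{(d,1)}=:Y^{(d)}$ almost surely for each $d$; * (random assignment) $Z$ is independent of $(Y^{(0)},Y^{(1)},D^{(0)},D^{(1)})$; * (consistency) $Y=(1-D)Y^{(0)}+DY^{(1)}$ and $D=\sum_{z}\mathbf 1(Z=z)D^{(z)}$ almost surely. Its observed law $\mathcal P$ is the law of $(Y,D,Z)$, and $\mathrm{ATE}=\mathbb E[Y^{(1)}-Y^{(0)}]$. Let $\mathbf p\in\mathbb R^{n\times2\times2}$ have entries $p_{id,z}=\mathcal P(Y=\gamma_i,D=d\mid Z=z)$,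 and let $\bar{\mathbf p}$ be the same vector for the conjugate law $\bar{\mathcal P}(Y=y,D=d,Z=z)=\mathcal P(Y=y,D=1-d,Z=z)$. **The set $\mathcal V$.** For a binary array $B=(B_{idz})\in\{0,1\}^{n\times2\times2}$ and $\alpha\in\mathbb R$ let $\mathbf u^{\alpha}(B)\in\mathbb R^{n\times2\times2}$ be given by $$u_{i00}=\begin{cases}-\gamma_i-\alpha& B_{i00}=1\\ \gamma_0&\text{else}\end{cases}\quad u_{i10}=\begin{cases}\gamma_i& B_{i10}=1\\ -\gamma_{n-1}-\alpha&\text{else}\end{cases}\quad u_{i01}=\begin{cases}-\gamma_i& B_{i01}=1\\ \gamma_0+\alpha&\text{else}\end{cases}\quad u_{i11}=\begin{cases}\gamma_i+\alpha& B_{i11}=1\\ -\gamma_{n-1}&\text{else.}\end{cases}$$ Let $\mathcal V$ be the (finite, non-empty) set of all vectors $\mathbf u^{\alpha}(B)$ where one of the following holds: 1. for some $t\in[n-1]$: $B_{i00}=B_{i01}=1$ for all $i\ge t$, $B_{i00}\ne B_{i01}$ for all $i<t$, $B_{i10}\neq B_{i11}$ for all $i\in[n]$, there are $i,j$ with $B_{i10}=B_{j11}=1$,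 and $\alpha=-\gamma_0-\gamma_t$; 2. $B_{(n-1)00}=B_{(n-1)01}=B_{010}=B_{011}=1$, $B_{i00}\ne B_{i01}$ for all $i<n-1$, $B_{j10}\ne B_{j11}$ for all $j>0$, and $\alpha=-\gamma_0-\gamma_{n-1}$; 3. for some $t\in[n-1]$: $B_{i10}=B_{i11}=1$ for all $i\le t+1$, $B_{i10}\ne B_{i11}$ for all $i>t+1$, $B_{i00}\ne B_{i01}$ for all $i\in[n]$, there are $i,j$ with $B_{i00}=B_{j01}=1$, and $\alpha=-\gamma_{t+1}-\gamma_{n-1}$. **Theorem.** * (Validity) In every IV model, $$\max_{\mathbf v\in\mathcal V}\mathbf v^\top\mathbf p\;\le\;\mathrm{ATE}\;\le\;-\max_{\mathbf v\in\mathcal V}\mathbf v^\top\bar{\mathbf p}.$$ * (Sharpness) For the observed law $\mathcal P$ of any IV model there are an IV model with observed law $\mathcal P$ whose ATE equals the lower bound, and an IV model with observed law $\mathcal P$ whose ATE equals the upper bound. * (No term can be dropped) For every $\mathbf v\in\mathcal V$ there is an IV model with $\mathbf w^\top\mathbf p<\mathbf v^\top\mathbf p$ for all $\mathbf w\in\mathcal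 V\setminus\{\mathbf v\}$, and there is an IV model with $\mathbf w^\top\bar{\mathbf p}<\mathbf v^\top\bar{\mathbf p}$ for all $\mathbf w\in\mathcal V\setminus\{\mathbf v\}$. -/

import Mathlib

open MeasureTheory ProbabilityTheory

/-! ### The instrumental variable model with a binary treatment and a binary instrument

The outcome support is `γ 0 < ⋯ < γ m`, that is, `n = m + 1` values. -/

/-- The random variables of the model on a common sample space `Ω`:
* `Ypot d z` is the potential outcome under treatment `d` and instrument value `z`;
* `Dpot z` is the potential treatment under instrument value `z`;
* `Z`, `D`, `Y` are the observed instrument, treatment and outcome. -/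
structure IVData (Ω : Type*) where
  Ypot : Fin 2 → Fin 2 → Ω → ℝ
  Dpot : Fin 2 → Ω → Fin 2
  Z : Ω → Fin 2
  D : Ω → Fin 2
  Y : Ω → ℝ

namespace IVData

variable {Ω : Type*}

/-- The potential outcome `Y^{(d)}`. Under individual-level exclusion `Ypot d z` does not
depend on `z` up to null sets, so any instrument value may be used to define it. -/
def Yd (X : IVData Ω) (d : Fin 2) : Ω → ℝ := X.Ypot d 0

/-- The law of the observed triple `(Y, D, Z)`. -/
noncomputable def observedLaw [MeasurableSpace Ω] (X : IVData Ω) (μ : Measure Ω) :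
    Measure (ℝ × Fin 2 × Fin 2) :=
  μ.map (fun ω => (X.Y ω, X.D ω, X.Z ω))

/-- The average treatment effect `E[Y^{(1)} - Y^{(0)}]`. -/
noncomputable def ATE [MeasurableSpace Ω] (X : IVData Ω) (μ : Measure Ω) : ℝ :=
  ∫ ω, (X.Yd 1 ω - X.Yd 0 ω) ∂μ

end IVData

/-- The maintained assumptions of the model. -/
structure IsIVModel {m : ℕ} (γ : Fin (m + 1) → ℝ) {Ω : Type*} [MeasurableSpace Ω]
    (μ : Measure Ω) (X : IVData Ω) : Prop where
  prob : IsProbabilityMeasure μ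
  measurable_Ypot : ∀ d z, Measurable (X.Ypot d z)
  measurable_Dpot : ∀ z, Measurable (X.Dpot z)
  measurable_Z : Measurable X.Z
  measurable_D : Measurable X.D
  measurable_Y : Measurable X.Y
  /-- Outcomes take values in `{γ 0, …, γ m}`. -/
  support : ∀ d z, ∀ᵐ ω ∂μ, X.Ypot d z ω ∈ Set.range γ
  /-- Every instrument value has positive probability. -/
  instrument_pos : ∀ z, μ {ω | X.Z ω = z} ≠ 0
  /-- Individual-level exclusion. -/
  exclusion : ∀ d z z', X.Ypot d z =ᵐ[μ] X.Ypot d z'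
  /-- Random assignment. -/
  random_assignment :
    IndepFun X.Z (fun ω => (X.Yd 0 ω, X.Yd 1 ω, X.Dpot 0 ω, X.Dpot 1 ω)) μ
  /-- Consistency of the outcome: `Y = (1 - D) Y^{(0)} + D Y^{(1)}`. -/
  consistency_Y : ∀ᵐ ω ∂μ,
    X.Y ω = (1 - ((X.D ω : ℕ) : ℝ)) * X.Yd 0 ω + ((X.D ω : ℕ) : ℝ) * X.Yd 1 ω
  /-- Consistency of the treatment: `D = ∑ z, 1(Z = z) D^{(z)}`. -/
  consistency_D : ∀ᵐ ω ∂μ,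
    (X.D ω : ℕ) = ∑ z : Fin 2, if X.Z ω = z then (X.Dpot z ω : ℕ) else 0

/-- `p_{id,z} = P(Y = γ i, D = d | Z = z)` for a law `P` of `(Y, D, Z)`. -/
noncomputable def condVec {m : ℕ} (γ : Fin (m + 1) → ℝ) (P : Measure (ℝ × Fin 2 × Fin 2)) :
    Fin (m + 1) → Fin 2 → Fin 2 → ℝ :=
  fun i d z => (cond P {x | x.2.2 = z}).real {x | x.1 = γ i ∧ x.2.1 = d}

/-- The conjugate law: the treatment label `d` is replaced by `1 - d`. -/
noncomputable def conjugateLaw (P : Measure (ℝ × Fin 2 × Fin 2)) :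
    Measure (ℝ × Fin 2 × Fin 2) :=
  P.map (fun x => (x.1, 1 - x.2.1, x.2.2))

/-- The inner product `vᵀ p`. -/
def pairing {m : ℕ} (v p : Fin (m + 1) → Fin 2 → Fin 2 → ℝ) : ℝ :=
  ∑ i, ∑ d, ∑ z, v i d z * p i d z

/-! ### Admissible signatures and the vertex map -/

/-- `B` belongs to the first family, with threshold index `t ∈ {0, …, n - 2}`. -/
def InS1 {m : ℕ} (t : Fin m) (B : Fin (m + 1) → Fin 2 → Fin 2 → Bool) : Prop :=
  (∀ i, t.castSucc ≤ i → B i 0 0 = true ∧ B i 0 1 = true) ∧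
  (∀ i, i < t.castSucc → B i 0 0 ≠ B i 0 1) ∧
  (∀ i, B i 1 0 ≠ B i 1 1) ∧
  (∃ i j, B i 1 0 = true ∧ B j 1 1 = true)

/-- `B` belongs to the second family. -/
def InS2 {m : ℕ} (B : Fin (m + 1) → Fin 2 → Fin 2 → Bool) : Prop :=
  (B (Fin.last m) 0 0 = true ∧ B (Fin.last m) 0 1 = true ∧ B 0 1 0 = true ∧ B 0 1 1 = true) ∧
  (∀ i, i < Fin.last m → B i 0 0 ≠ B i 0 1) ∧
  (∀ j, 0 < j → B j 1 0 ≠ B j 1 1)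

/-- `B` belongs to the third family, with threshold index `t + 1 ∈ {1, …, n - 1}`. -/
def InS3 {m : ℕ} (t : Fin m) (B : Fin (m + 1) → Fin 2 → Fin 2 → Bool) : Prop :=
  (∀ i, i ≤ t.succ → B i 1 0 = true ∧ B i 1 1 = true) ∧
  (∀ i, t.succ < i → B i 1 0 ≠ B i 1 1) ∧
  (∀ i, B i 0 0 ≠ B i 0 1) ∧
  (∃ i j, B i 0 0 = true ∧ B j 0 1 = true)

/-- The vector `u(B)` for a given value of the constant `α`. -/
def vertexMap {m : ℕ} (γ : Fin (m + 1) → ℝ) (α : ℝ)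
    (B : Fin (m + 1) → Fin 2 → Fin 2 → Bool) : Fin (m + 1) → Fin 2 → Fin 2 → ℝ :=
  fun i d z =>
    match d, z with
    | 0, 0 => if B i 0 0 then -γ i - α else γ 0
    | 1, 0 => if B i 1 0 then γ i else -γ (Fin.last m) - α
    | 0, 1 => if B i 0 1 then -γ i else γ 0 + α
    | 1, 1 => if B i 1 1 then γ i + α else -γ (Fin.last m)

/-- The set `𝒱` of the vectors `u(B)`, `B` an admissible signature. The constant `α` is
`-γ₀ - γ_t` on the first family, `-γ₀ - γ_{n-1}` on the second, and `-γ_s - γ_{n-1}` on the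
third, where `s = t + 1` is the largest index with `B s 1 0 = B s 1 1 = 1`. -/
def vertexSet {m : ℕ} (γ : Fin (m + 1) → ℝ) : Set (Fin (m + 1) → Fin 2 → Fin 2 → ℝ) :=
  {v | (∃ t B, InS1 t B ∧ v = vertexMap γ (-γ 0 - γ t.castSucc) B) ∨
       (∃ B, InS2 B ∧ v = vertexMap γ (-γ 0 - γ (Fin.last m)) B) ∨
       (∃ t B, InS3 t B ∧ v = vertexMap γ (-γ t.succ - γ (Fin.last m)) B)}

theorem vertexSet_finite {m : ℕ} (γ : Fin (m + 1) → ℝ) : (vertexSet γ).Finite := by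
  refine (((Set.finite_range fun x : Fin m × (Fin (m + 1) → Fin 2 → Fin 2 → Bool) =>
      vertexMap γ (-γ 0 - γ x.1.castSucc) x.2).union
    (Set.finite_range fun B : Fin (m + 1) → Fin 2 → Fin 2 → Bool =>
      vertexMap γ (-γ 0 - γ (Fin.last m)) B)).union
    (Set.finite_range fun x : Fin m × (Fin (m + 1) → Fin 2 → Fin 2 → Bool) =>
      vertexMap γ (-γ x.1.succ - γ (Fin.last m)) x.2)).subset ?_
  rintro v (⟨t, B, -, rfl⟩ | ⟨B, -, rfl⟩ | ⟨t, B, -, rfl⟩)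
  · exact Or.inl (Or.inl ⟨(t, B), rfl⟩)
  · exact Or.inl (Or.inr ⟨B, rfl⟩)
  · exact Or.inr ⟨(t, B), rfl⟩

theorem vertexSet_nonempty {m : ℕ} (γ : Fin (m + 1) → ℝ) : (vertexSet γ).Nonempty := by
  refine ⟨_, Or.inr (Or.inl ⟨fun i d z =>
    decide (z = 0 ∨ (d = 0 ∧ i = Fin.last m) ∨ (d = 1 ∧ i = 0)), ?_, rfl⟩)⟩
  refine ⟨by simp, fun i hi => ?_, fun j hj => ?_⟩
  · simp [hi.ne]
  · simp [hj.ne']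

/-- `max_{v ∈ 𝒱} vᵀ p`, the maximum over a finite non-empty set. -/
noncomputable def vertexMax {m : ℕ} (γ : Fin (m + 1) → ℝ)
    (p : Fin (m + 1) → Fin 2 → Fin 2 → ℝ) : ℝ :=
  (vertexSet_finite γ).toFinset.sup'
    ((Set.Finite.toFinset_nonempty _).2 (vertexSet_nonempty γ)) (fun v => pairing v p)

/-! A latent type records both potential outcomes and both potential treatments. The observed law is
a linear image of the law of the latent type and the average effect is a linear functional of it, so
both sharp bounds are values of linear programs over a simplex. The dual constraints of the types
whose treatment responds to the instrument bound a dual vector, up to a translation, by an explicit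
envelope that depends on one parameter `α`. For fixed `α` the best dual vector is explicit, and its
value is a piecewise linear function of `α` whose maximum is attained at a breakpoint, that is, at a
vertex `u(B)`. Strong duality gives sharpness. No other vertex is tight at all the types at which a
given vertex is tight, so a type distribution charging exactly these makes every other term strictly
smaller. Interchanging the treatments turns the lower bound into the upper one. -/

/-! ### Latent types and dual feasibility -/

theorem sum_fin_two_eq_add_one_sub {M : Type*} [AddCommMonoid M] (f : Fin 2 → M) (d : Fin 2) :
    ∑ e, f e = f d + f (1 - d) := by
  match d with
  | 0 => simp
  | 1 => simp [add_comm]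

section Latent

variable {m : ℕ}

/-- A latent type: the indices of the two potential outcomes, as a function of the treatment, and
the two potential treatments, as a function of the instrument. -/
abbrev Latent (m : ℕ) : Type := (Fin 2 → Fin (m + 1)) × (Fin 2 → Fin 2)

/-- The treatment effect of a latent type. -/
def effect (γ : Fin (m + 1) → ℝ) (k : Latent m) : ℝ := γ (k.1 1) - γ (k.1 0)

/-- The conditional law of outcome and treatment given the instrument when everyone has latent
type `k`: the column of `k` in the constraint matrix of the linear program. -/
def column (k : Latent m) : Fin (m + 1) → Fin 2 → Fin 2 → ℝ :=
  fun i d z => if k.1 (k.2 z) = i ∧ k.2 z = d then 1 else 0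

/-- The conditional law of outcome and treatment given the instrument in a population with the
weights `q` on the latent types. -/
def obs (q : Latent m → ℝ) : Fin (m + 1) → Fin 2 → Fin 2 → ℝ := ∑ k, q k • column k

/-- The sign with which `Y^{(d)}` enters the treatment effect `Y^{(1)} - Y^{(0)}`. -/
def effectSign (d : Fin 2) : ℝ := if d = 0 then -1 else 1

/-- The index of the value of `Y^{(1-d)}` that minimises the treatment effect when `Y^{(d)}` is
held fixed. -/
def worstIndex (m : ℕ) (d : Fin 2) : Fin (m + 1) := if d = 0 then 0 else Fin.last m

@[simp]
theorem effectSign_zero : effectSign 0 = -1 := if_pos rfl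

@[simp]
theorem effectSign_one : effectSign 1 = 1 := if_neg one_ne_zero

theorem effectSign_one_sub (d : Fin 2) : effectSign (1 - d) = -effectSign d := by
  fin_cases d <;> simp [effectSign]

theorem effectSign_mul_self (d : Fin 2) : effectSign d * effectSign d = 1 := by
  fin_cases d <;> simp [effectSign]

theorem effect_eq_effectSign_mul (γ : Fin (m + 1) → ℝ) (k : Latent m) (d : Fin 2) :
    effect γ k = effectSign d * (γ (k.1 d) - γ (k.1 (1 - d))) := by
  fin_cases d <;> simp [effect, effectSign]

theorem effectSign_mul_le_worstIndex {γ : Fin (m + 1) → ℝ} (hγ : Monotone γ) (d : Fin 2)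
    (i : Fin (m + 1)) : effectSign d * γ i ≤ effectSign d * γ (worstIndex m d) := by
  fin_cases d
  · simpa [effectSign, worstIndex] using hγ (Fin.zero_le i)
  · simpa [effectSign, worstIndex] using hγ (Fin.le_last i)

theorem pairing_column (u : Fin (m + 1) → Fin 2 → Fin 2 → ℝ) (k : Latent m) :
    pairing u (column k) = ∑ z, u (k.1 (k.2 z)) (k.2 z) z := by
  unfold pairing column
  rw [Finset.sum_congr rfl fun i _ => Finset.sum_comm, Finset.sum_comm]
  simp [ite_and]

theorem pairing_sum_smul {ι : Type*} (s : Finset ι) (u : Fin (m + 1) → Fin 2 → Fin 2 → ℝ)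
    (q : ι → ℝ) (p : ι → Fin (m + 1) → Fin 2 → Fin 2 → ℝ) :
    pairing u (∑ k ∈ s, q k • p k) = ∑ k ∈ s, q k * pairing u (p k) := by
  simp only [pairing, Finset.sum_apply, Pi.smul_apply, smul_eq_mul, Finset.mul_sum]
  simp_rw [Finset.sum_comm (t := s)]
  simp only [mul_left_comm]

theorem pairing_obs (u : Fin (m + 1) → Fin 2 → Fin 2 → ℝ) (q : Latent m → ℝ) :
    pairing u (obs q) = ∑ k, q k * pairing u (column k) :=
  pairing_sum_smul _ u q column

theorem pairing_add_left (u v p : Fin (m + 1) → Fin 2 → Fin 2 → ℝ) :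
    pairing (u + v) p = pairing u p + pairing v p := by
  simp only [pairing, Pi.add_apply, add_mul, Finset.sum_add_distrib]

/-- The latent types with both potential treatments equal to `d`, with `Y^{(d)} = γ i` and the
value of `Y^{(1-d)}` that minimises the effect. -/
def nonresponder (d : Fin 2) (i : Fin (m + 1)) : Latent m :=
  (Function.update (fun _ => worstIndex m d) d i, fun _ => d)

/-- The latent type with potential treatment `0` at the instrument value `z` only, and potential
outcomes `γ a` and `γ b`. -/
def responder (z : Fin 2) (a b : Fin (m + 1)) : Latent m :=
  (![a, b], fun z' => if z' = z then 0 else 1)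

theorem pairing_column_nonresponder (u : Fin (m + 1) → Fin 2 → Fin 2 → ℝ) (d : Fin 2)
    (i : Fin (m + 1)) : pairing u (column (nonresponder d i)) = ∑ z, u i d z := by
  simp [pairing_column, nonresponder]

theorem effect_nonresponder (γ : Fin (m + 1) → ℝ) (d : Fin 2) (i : Fin (m + 1)) :
    effect γ (nonresponder d i) = effectSign d * (γ i - γ (worstIndex m d)) := by
  rw [effect_eq_effectSign_mul γ _ d]
  fin_cases d <;> simp [nonresponder]

theorem pairing_column_responder (u : Fin (m + 1) → Fin 2 → Fin 2 → ℝ) (z : Fin 2)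
    (a b : Fin (m + 1)) :
    pairing u (column (responder z a b)) = u a 0 z + u b 1 (1 - z) := by
  fin_cases z
  · simp [pairing_column, responder]
  · simp [pairing_column, responder, add_comm (u b 1 0)]

theorem effect_responder (γ : Fin (m + 1) → ℝ) (z : Fin 2) (a b : Fin (m + 1)) :
    effect γ (responder z a b) = γ b - γ a := by
  simp [effect, responder]

/-- Feasibility for the dual of the program that minimises the average effect. -/
def DualFeasible (γ : Fin (m + 1) → ℝ) (u : Fin (m + 1) → Fin 2 → Fin 2 → ℝ) : Prop :=
  ∀ k, pairing u (column k) ≤ effect γ k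

/-- Each latent type is dominated by a nonresponder with the same observables, or is a
responder. -/
theorem dualFeasible_iff {γ : Fin (m + 1) → ℝ} (hγ : Monotone γ)
    {u : Fin (m + 1) → Fin 2 → Fin 2 → ℝ} :
    DualFeasible γ u ↔
      (∀ i d, ∑ z, u i d z ≤ effectSign d * (γ i - γ (worstIndex m d))) ∧
      ∀ a b z, u a 0 z + u b 1 (1 - z) ≤ γ b - γ a := by
  refine ⟨fun h => ⟨fun i d => ?_, fun a b z => ?_⟩, fun ⟨hnon, hresp⟩ k => ?_⟩
  · simpa only [pairing_column_nonresponder, effect_nonresponder] using h (nonresponder d i)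
  · simpa only [pairing_column_responder, effect_responder] using h (responder z a b)
  · by_cases hk : k.2 0 = k.2 1
    · have hle := hnon (k.1 (k.2 0)) (k.2 0)
      have hworst := effectSign_mul_le_worstIndex hγ (k.2 0) (k.1 (1 - k.2 0))
      rw [pairing_column, effect_eq_effectSign_mul γ k (k.2 0)]
      simp only [Fin.sum_univ_two, ← hk] at hle ⊢
      linarith
    · obtain ⟨z, hz, hz'⟩ : ∃ z, k.2 z = 0 ∧ k.2 (1 - z) = 1 := by
        by_cases h : k.2 0 = 0
        · exact ⟨0, h, by rw [sub_zero]; omega⟩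
        · exact ⟨1, by omega, by rw [sub_self]; omega⟩
      have hle := hresp (k.1 0) (k.1 1) z
      rw [pairing_column]
      fin_cases z <;> simp_all [effect, add_comm]

end Latent

/-! ### Vertices -/

section Vertices

variable {m : ℕ} {γ : Fin (m + 1) → ℝ} {α : ℝ} {B : Fin (m + 1) → Fin 2 → Fin 2 → Bool}

/-- The amount by which the two entries of the upper envelope at outcome `i` and treatment `d`
exceed the dual constraint on their sum, see `sum_envelope`. -/
def slack (γ : Fin (m + 1) → ℝ) (α : ℝ) (i : Fin (m + 1)) (d : Fin 2) : ℝ :=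
  effectSign d * (γ i + γ (worstIndex m d) + α)

theorem slack_zero (γ : Fin (m + 1) → ℝ) (α : ℝ) (i : Fin (m + 1)) :
    slack γ α i 0 = -(γ i + γ 0 + α) := by
  simp [slack, effectSign, worstIndex]

theorem slack_one (γ : Fin (m + 1) → ℝ) (α : ℝ) (i : Fin (m + 1)) :
    slack γ α i 1 = γ i + γ (Fin.last m) + α := by
  simp [slack, effectSign, worstIndex]

/-- The largest dual variables compatible with the constraints of the responders, up to a
translation along `tilt`. -/
def envelope (γ : Fin (m + 1) → ℝ) (α : ℝ) : Fin (m + 1) → Fin 2 → Fin 2 → ℝ :=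
  fun i d z => effectSign d * (γ i + if z = d then α else 0)

theorem envelope_self (γ : Fin (m + 1) → ℝ) (α : ℝ) (i : Fin (m + 1)) (d : Fin 2) :
    envelope γ α i d d = effectSign d * (γ i + α) := by
  rw [envelope, if_pos rfl]

theorem envelope_one_sub (γ : Fin (m + 1) → ℝ) (α : ℝ) (i : Fin (m + 1)) (d : Fin 2) :
    envelope γ α i d (1 - d) = effectSign d * γ i := by
  rw [envelope, if_neg (by omega), add_zero]

theorem sum_envelope (γ : Fin (m + 1) → ℝ) (α : ℝ) (i : Fin (m + 1)) (d : Fin 2) :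
    ∑ z, envelope γ α i d z = effectSign d * (γ i - γ (worstIndex m d)) + slack γ α i d := by
  rw [sum_fin_two_eq_add_one_sub _ d, envelope_self, envelope_one_sub, slack]
  ring

theorem envelope_zero_add_envelope_one (γ : Fin (m + 1) → ℝ) (α : ℝ) (a b : Fin (m + 1))
    (z : Fin 2) : envelope γ α a 0 z + envelope γ α b 1 (1 - z) = γ b - γ a := by
  match z with
  | 0 =>
    rw [sub_zero, envelope_self, envelope_self, effectSign_zero, effectSign_one]
    ring
  | 1 =>
    have h₀ : envelope γ α a 0 1 = effectSign 0 * γ a := envelope_one_sub γ α a 0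
    have h₁ : envelope γ α b 1 0 = effectSign 1 * γ b := envelope_one_sub γ α b 1
    rw [sub_self, h₀, h₁, effectSign_zero, effectSign_one]
    ring

theorem vertexMap_eq_envelope_sub (γ : Fin (m + 1) → ℝ) (α : ℝ)
    (B : Fin (m + 1) → Fin 2 → Fin 2 → Bool) (i : Fin (m + 1)) (d z : Fin 2) :
    vertexMap γ α B i d z = envelope γ α i d z - if B i d z then 0 else slack γ α i d := by
  fin_cases d <;> fin_cases z <;>
    simp only [vertexMap, envelope, slack, effectSign, worstIndex] <;> split_ifs <;>
    simp_all <;> ring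

/-- The conditions on `α` and `B` that are common to the three families, in terms of signs of
slacks. -/
structure Admissible (γ : Fin (m + 1) → ℝ) (α : ℝ) (B : Fin (m + 1) → Fin 2 → Fin 2 → Bool) :
    Prop where
  status : ∀ i d, (∀ z, B i d z = true) ∧ slack γ α i d ≤ 0 ∨
    B i d 0 ≠ B i d 1 ∧ 0 ≤ slack γ α i d
  exists_true : ∀ d z, ∃ i, B i d z = true
  tight : ∃ i d, (∀ z, B i d z = true) ∧ slack γ α i d = 0

theorem vertexMap_eq_envelope {i : Fin (m + 1)} {d z : Fin 2} (hB : B i d z = true) :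
    vertexMap γ α B i d z = envelope γ α i d z := by
  simp [vertexMap_eq_envelope_sub, hB]

theorem sum_vertexMap_of_forall_true {i : Fin (m + 1)} {d : Fin 2} (hB : ∀ z, B i d z = true) :
    ∑ z, vertexMap γ α B i d z =
      effectSign d * (γ i - γ (worstIndex m d)) + slack γ α i d := by
  rw [← sum_envelope]
  exact Finset.sum_congr rfl fun z _ => vertexMap_eq_envelope (hB z)

theorem sum_vertexMap_of_ne {i : Fin (m + 1)} {d : Fin 2} (hB : B i d 0 ≠ B i d 1) :
    ∑ z, vertexMap γ α B i d z = effectSign d * (γ i - γ (worstIndex m d)) := by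
  have hslack : ∑ z, (if B i d z then 0 else slack γ α i d) = slack γ α i d := by
    cases h₀ : B i d 0 <;> cases h₁ : B i d 1 <;> simp_all
  simp only [vertexMap_eq_envelope_sub, Finset.sum_sub_distrib, sum_envelope, hslack,
    add_sub_cancel_right]

namespace Admissible

theorem vertexMap_le_envelope (h : Admissible γ α B) : vertexMap γ α B ≤ envelope γ α := by
  intro i d z
  rw [vertexMap_eq_envelope_sub]
  rcases h.status i d with ⟨hB, -⟩ | ⟨-, hslack⟩
  · simp [hB z]
  · split_ifs <;> linarith

theorem sum_vertexMap_le (h : Admissible γ α B) (i : Fin (m + 1)) (d : Fin 2) :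
    ∑ z, vertexMap γ α B i d z ≤ effectSign d * (γ i - γ (worstIndex m d)) := by
  rcases h.status i d with ⟨hB, hslack⟩ | ⟨hB, -⟩
  · linarith [sum_vertexMap_of_forall_true (γ := γ) (α := α) hB]
  · exact (sum_vertexMap_of_ne hB).le

theorem dualFeasible (hγ : Monotone γ) (h : Admissible γ α B) :
    DualFeasible γ (vertexMap γ α B) :=
  (dualFeasible_iff hγ).2 ⟨h.sum_vertexMap_le, fun a b z =>
    (add_le_add (h.vertexMap_le_envelope a 0 z) (h.vertexMap_le_envelope b 1 (1 - z))).trans_eq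
      (envelope_zero_add_envelope_one γ α a b z)⟩

end Admissible

/-- The vector that spans the lineality space of the dual polyhedron: the columns have total
mass one at both instrument values. -/
def tilt (m : ℕ) : Fin (m + 1) → Fin 2 → Fin 2 → ℝ := fun _ _ z => if z = 0 then 1 else -1

theorem exists_eq_of_cross {δ : Fin (m + 1) → Fin 2 → Fin 2 → ℝ}
    (hB : ∀ d z, ∃ i, B i d z = true)
    (cross : ∀ a b z, B a 0 z = true → B b 1 (1 - z) = true → δ a 0 z + δ b 1 (1 - z) = 0) :
    ∃ e : Fin 2 → ℝ, ∀ i d z, B i d z = true → δ i d z = if d = 0 then e z else -e (1 - z) := by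
  choose a ha using hB 0
  choose b hb using hB 1
  refine ⟨fun z => δ (a z) 0 z, fun i d z hi => ?_⟩
  match d with
  | 0 =>
    rw [if_pos rfl]
    linarith [cross i _ z hi (hb (1 - z)), cross _ _ z (ha z) (hb (1 - z))]
  | 1 =>
    have h := cross _ i (1 - z) (ha (1 - z)) (by rwa [sub_sub_cancel])
    rw [sub_sub_cancel] at h
    rw [if_neg one_ne_zero]
    linarith

theorem Admissible.exists_eq_smul_tilt (h : Admissible γ α B)
    {δ : Fin (m + 1) → Fin 2 → Fin 2 → ℝ}
    (hδ : ∀ k, pairing (vertexMap γ α B) (column k) = effect γ k → pairing δ (column k) = 0) :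
    ∃ c : ℝ, δ = c • tilt m := by
  have sum_eq_zero (i d)
      (hi : ∑ z, vertexMap γ α B i d z = effectSign d * (γ i - γ (worstIndex m d))) :
      δ i d 0 + δ i d 1 = 0 := by
    rw [← Fin.sum_univ_two, ← pairing_column_nonresponder]
    exact hδ _ (by rw [pairing_column_nonresponder, effect_nonresponder, hi])
  obtain ⟨e, he⟩ := exists_eq_of_cross (δ := δ) h.exists_true fun a b z ha hb => by
    rw [← pairing_column_responder]
    exact hδ _ (by rw [pairing_column_responder, effect_responder, vertexMap_eq_envelope ha,
      vertexMap_eq_envelope hb, envelope_zero_add_envelope_one])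
  have he_add : e 0 + e 1 = 0 := by
    obtain ⟨i, d, hB, hslack⟩ := h.tight
    have hsum := sum_eq_zero i d (by rw [sum_vertexMap_of_forall_true hB, hslack, add_zero])
    rw [he i d 0 (hB 0), he i d 1 (hB 1), sub_zero, sub_self] at hsum
    split_ifs at hsum <;> linarith
  have of_true (i d z) (hB : B i d z = true) : δ i d z = (e 0 • tilt m) i d z := by
    rw [he i d z hB]
    match d, z with
    | 0, 0 | 0, 1 | 1, 0 | 1, 1 => simp [tilt, eq_neg_of_add_eq_zero_right he_add]
  refine ⟨e 0, ?_⟩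
  ext i d z
  rcases h.status i d with ⟨hB, -⟩ | ⟨hB, -⟩
  · exact of_true i d z (hB z)
  · have hsum := sum_eq_zero i d (sum_vertexMap_of_ne hB)
    have htilt : (e 0 • tilt m) i d 0 + (e 0 • tilt m) i d 1 = 0 := by simp [tilt]
    have hB' : B i d 0 = true ∨ B i d 1 = true := by
      cases h₀ : B i d 0
      · exact Or.inr (Bool.eq_true_of_not_eq_false fun h₁ => hB (h₀.trans h₁.symm))
      · exact Or.inl rfl
    rcases hB' with hi | hi <;> match z with
    | 0 | 1 => linarith [of_true i d _ hi]

theorem Admissible.vertexMap_eq_of_tight {α' : ℝ} {B' : Fin (m + 1) → Fin 2 → Fin 2 → Bool}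
    (h : Admissible γ α B) (h' : Admissible γ α' B')
    (htight : ∀ k, pairing (vertexMap γ α B) (column k) = effect γ k →
      pairing (vertexMap γ α' B') (column k) = effect γ k) :
    vertexMap γ α' B' = vertexMap γ α B := by
  obtain ⟨c, hc⟩ := h.exists_eq_smul_tilt (δ := vertexMap γ α' B' - vertexMap γ α B) fun k hk => by
    have hadd := pairing_add_left (vertexMap γ α B) (vertexMap γ α' B' - vertexMap γ α B) (column k)
    rw [add_sub_cancel, htight k hk, hk] at hadd
    exact left_eq_add.1 hadd
  -- At `d = 0`, `z = 1` both vertices touch the envelope `-γ`, so they cannot differ by a shift.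
  have shift (i) : vertexMap γ α' B' i 0 1 = vertexMap γ α B i 0 1 - c := by
    have := congrFun (congrFun (congrFun hc i) 0) 1
    simp only [Pi.sub_apply, Pi.smul_apply, tilt, one_ne_zero, if_false, smul_eq_mul, mul_neg,
      mul_one] at this
    linarith
  have envelope_eq (α i) : envelope γ α i 0 1 = -γ i := by simp [envelope, effectSign]
  obtain ⟨a, ha⟩ := h.exists_true 0 1
  obtain ⟨a', ha'⟩ := h'.exists_true 0 1
  have hca := h'.vertexMap_le_envelope a 0 1
  have hca' := h.vertexMap_le_envelope a' 0 1
  rw [envelope_eq, shift, vertexMap_eq_envelope ha, envelope_eq] at hca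
  rw [envelope_eq, ← sub_add_cancel (vertexMap γ α B a' 0 1) c, ← shift, vertexMap_eq_envelope ha',
    envelope_eq] at hca'
  rw [← sub_eq_zero, hc, show c = 0 by linarith, zero_smul]

end Vertices

section Families

variable {m : ℕ} {γ : Fin (m + 1) → ℝ} {α : ℝ} {B : Fin (m + 1) → Fin 2 → Fin 2 → Bool}

/-- The value of `α` in the second family. -/
def centralShift (γ : Fin (m + 1) → ℝ) : ℝ := -γ 0 - γ (Fin.last m)

theorem slack_worstIndex (γ : Fin (m + 1) → ℝ) (α : ℝ) (d : Fin 2) :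
    slack γ α (worstIndex m (1 - d)) d = effectSign d * (α - centralShift γ) := by
  match d with
  | 0 => rw [slack_zero, effectSign_zero, worstIndex, if_neg (by simp), centralShift]; ring
  | 1 => rw [slack_one, effectSign_one, worstIndex, if_pos (sub_self 1), centralShift]; ring

theorem InS1.admissible (hγ : Monotone γ) {t : Fin m} (hB : InS1 t B) :
    Admissible γ (-γ 0 - γ t.castSucc) B := by
  obtain ⟨both, single, single', i, j, hi, hj⟩ := hB
  refine ⟨fun k d => ?_, fun d z => ?_, t.castSucc, 0, Fin.forall_fin_two.2 (both _ le_rfl), ?_⟩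
  · match d with
    | 0 =>
      rw [slack_zero]
      rcases le_or_gt t.castSucc k with hk | hk
      · exact Or.inl ⟨Fin.forall_fin_two.2 (both k hk), by linarith [hγ hk]⟩
      · exact Or.inr ⟨single k hk, by linarith [hγ hk.le]⟩
    | 1 =>
      rw [slack_one]
      exact Or.inr ⟨single' k, by linarith [hγ (Fin.zero_le k), hγ (Fin.le_last t.castSucc)]⟩
  · match d, z with
    | 0, 0 => exact ⟨_, (both _ le_rfl).1⟩
    | 0, 1 => exact ⟨_, (both _ le_rfl).2⟩
    | 1, 0 => exact ⟨i, hi⟩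
    | 1, 1 => exact ⟨j, hj⟩
  · rw [slack_zero]; ring

theorem InS2.admissible (hγ : Monotone γ) (hB : InS2 B) : Admissible γ (centralShift γ) B := by
  obtain ⟨⟨h00, h01, h10, h11⟩, single, single'⟩ := hB
  have hslack (d) : slack γ (centralShift γ) (worstIndex m (1 - d)) d = 0 := by
    rw [slack_worstIndex, sub_self, mul_zero]
  refine ⟨fun k d => ?_, fun d z => ?_, Fin.last m, 0, Fin.forall_fin_two.2 ⟨h00, h01⟩, hslack 0⟩
  · match d with
    | 0 =>
      rcases (Fin.le_last k).eq_or_lt with rfl | hk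
      · exact Or.inl ⟨Fin.forall_fin_two.2 ⟨h00, h01⟩, (hslack 0).le⟩
      · refine Or.inr ⟨single k hk, ?_⟩
        rw [slack_zero, centralShift]
        linarith [hγ hk.le]
    | 1 =>
      rcases (Fin.zero_le k).eq_or_lt with rfl | hk
      · exact Or.inl ⟨Fin.forall_fin_two.2 ⟨h10, h11⟩, (hslack 1).le⟩
      · refine Or.inr ⟨single' k hk, ?_⟩
        rw [slack_one, centralShift]
        linarith [hγ hk.le]
  · match d, z with
    | 0, 0 => exact ⟨_, h00⟩
    | 0, 1 => exact ⟨_, h01⟩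
    | 1, 0 => exact ⟨_, h10⟩
    | 1, 1 => exact ⟨_, h11⟩

theorem InS3.admissible (hγ : Monotone γ) {t : Fin m} (hB : InS3 t B) :
    Admissible γ (-γ t.succ - γ (Fin.last m)) B := by
  obtain ⟨both, single, single', i, j, hi, hj⟩ := hB
  refine ⟨fun k d => ?_, fun d z => ?_, t.succ, 1, Fin.forall_fin_two.2 (both _ le_rfl), ?_⟩
  · match d with
    | 0 =>
      rw [slack_zero]
      exact Or.inr ⟨single' k, by linarith [hγ (Fin.zero_le t.succ), hγ (Fin.le_last k)]⟩
    | 1 =>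
      rw [slack_one]
      rcases le_or_gt k t.succ with hk | hk
      · exact Or.inl ⟨Fin.forall_fin_two.2 (both k hk), by linarith [hγ hk]⟩
      · exact Or.inr ⟨single k hk, by linarith [hγ hk.le]⟩
  · match d, z with
    | 0, 0 => exact ⟨i, hi⟩
    | 0, 1 => exact ⟨j, hj⟩
    | 1, 0 => exact ⟨_, (both _ le_rfl).1⟩
    | 1, 1 => exact ⟨_, (both _ le_rfl).2⟩
  · rw [slack_one]; ring

theorem exists_admissible_of_mem_vertexSet (hγ : Monotone γ)
    {v : Fin (m + 1) → Fin 2 → Fin 2 → ℝ} (hv : v ∈ vertexSet γ) :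
    ∃ α B, Admissible γ α B ∧ v = vertexMap γ α B := by
  obtain ⟨t, B, hB, rfl⟩ | ⟨B, hB, rfl⟩ | ⟨t, B, hB, rfl⟩ := hv
  · exact ⟨_, B, hB.admissible hγ, rfl⟩
  · exact ⟨_, B, hB.admissible hγ, rfl⟩
  · exact ⟨_, B, hB.admissible hγ, rfl⟩

namespace Admissible

theorem forall_true_of_slack_neg (h : Admissible γ α B) {i : Fin (m + 1)} {d : Fin 2}
    (hs : slack γ α i d < 0) (z : Fin 2) : B i d z = true := by
  rcases h.status i d with ⟨hB, -⟩ | ⟨-, hs'⟩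
  · exact hB z
  · exact absurd hs hs'.not_gt

theorem ne_of_slack_pos (h : Admissible γ α B) {i : Fin (m + 1)} {d : Fin 2}
    (hs : 0 < slack γ α i d) : B i d 0 ≠ B i d 1 := by
  rcases h.status i d with ⟨-, hs'⟩ | ⟨hB, -⟩
  · exact absurd hs hs'.not_gt
  · exact hB

theorem inS1 (hγ : StrictMono γ) {t : Fin m} (h : Admissible γ (-γ 0 - γ t.castSucc) B)
    (ht : ∀ z, B t.castSucc 0 z = true) : InS1 t B := by
  refine ⟨fun k hk => ?_, fun k hk => h.ne_of_slack_pos ?_, fun k => h.ne_of_slack_pos ?_, ?_⟩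
  · rcases hk.eq_or_lt with rfl | hk
    · exact ⟨ht 0, ht 1⟩
    · have hs : slack γ (-γ 0 - γ t.castSucc) k 0 < 0 := by
        rw [slack_zero]
        linarith [hγ hk]
      exact ⟨h.forall_true_of_slack_neg hs 0, h.forall_true_of_slack_neg hs 1⟩
  · rw [slack_zero]
    linarith [hγ hk]
  · rw [slack_one]
    linarith [hγ t.castSucc_lt_last, hγ.monotone (Fin.zero_le k)]
  · obtain ⟨i, hi⟩ := h.exists_true 1 0
    obtain ⟨j, hj⟩ := h.exists_true 1 1
    exact ⟨i, j, hi, hj⟩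

theorem inS3 (hγ : StrictMono γ) {t : Fin m} (h : Admissible γ (-γ t.succ - γ (Fin.last m)) B)
    (ht : ∀ z, B t.succ 1 z = true) : InS3 t B := by
  refine ⟨fun k hk => ?_, fun k hk => h.ne_of_slack_pos ?_, fun k => h.ne_of_slack_pos ?_, ?_⟩
  · rcases hk.eq_or_lt with rfl | hk
    · exact ⟨ht 0, ht 1⟩
    · have hs : slack γ (-γ t.succ - γ (Fin.last m)) k 1 < 0 := by
        rw [slack_one]
        linarith [hγ hk]
      exact ⟨h.forall_true_of_slack_neg hs 0, h.forall_true_of_slack_neg hs 1⟩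
  · rw [slack_one]
    linarith [hγ hk]
  · rw [slack_zero]
    linarith [hγ t.succ_pos, hγ.monotone (Fin.le_last k)]
  · obtain ⟨i, hi⟩ := h.exists_true 0 0
    obtain ⟨j, hj⟩ := h.exists_true 0 1
    exact ⟨i, j, hi, hj⟩

/-- The slacks of the two outcomes added to `B` vanish, so that the vertex does not change. -/
theorem exists_inS2 (hγ : StrictMono γ) (h : Admissible γ (centralShift γ) B) :
    ∃ B', InS2 B' ∧ vertexMap γ (centralShift γ) B = vertexMap γ (centralShift γ) B' := by
  refine ⟨fun i d z => decide (i = worstIndex m (1 - d)) || B i d z,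
    ⟨⟨?_, ?_, ?_, ?_⟩, fun k hk => ?_, fun k hk => ?_⟩, ?_⟩
  iterate 4 simp [worstIndex]
  · simpa [worstIndex, hk.ne] using h.ne_of_slack_pos (i := k) (d := 0) (by
      rw [slack_zero, centralShift]
      linarith [hγ hk])
  · simpa [worstIndex, hk.ne'] using h.ne_of_slack_pos (i := k) (d := 1) (by
      rw [slack_one, centralShift]
      linarith [hγ hk])
  · ext i d z
    rw [vertexMap_eq_envelope_sub, vertexMap_eq_envelope_sub]
    by_cases hi : i = worstIndex m (1 - d)
    · simp [hi, slack_worstIndex]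
    · simp [hi]

theorem vertexMap_mem_vertexSet (hγ : StrictMono γ) (h : Admissible γ α B) :
    vertexMap γ α B ∈ vertexSet γ := by
  by_cases hα : α = centralShift γ
  · subst hα
    obtain ⟨B', hB', heq⟩ := h.exists_inS2 hγ
    exact Or.inr (Or.inl ⟨B', hB', heq⟩)
  obtain ⟨i, d, hB, hs⟩ := h.tight
  match d with
  | 0 =>
    rw [slack_zero] at hs
    obtain rfl : α = -γ 0 - γ i := by linarith
    obtain ⟨t, rfl⟩ := Fin.exists_castSucc_eq.2 fun (hi : i = Fin.last m) =>
      hα (by rw [hi, centralShift])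
    exact Or.inl ⟨t, B, h.inS1 hγ hB, rfl⟩
  | 1 =>
    rw [slack_one] at hs
    obtain rfl : α = -γ i - γ (Fin.last m) := by linarith
    obtain ⟨t, rfl⟩ := Fin.exists_succ_eq.2 fun (hi : i = 0) => hα (by rw [hi, centralShift])
    exact Or.inr (Or.inr ⟨t, B, h.inS3 hγ hB, rfl⟩)

end Admissible

end Families

/-! ### The dual value as a function of the shift -/

theorem exists_le_of_monotoneOn_of_antitoneOn {α β : Type*} [LinearOrder α] [LinearOrder β]
    {f : α → β} {T : Set α} (hT : T.Finite)
    (hne : T.Nonempty) (hmono : MonotoneOn f (lowerBounds T)) (hanti : AntitoneOn f (upperBounds T))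
    (hgap : ∀ a ∈ T, ∀ b ∈ T, Disjoint (Set.Ioo a b) T → ∀ s ∈ Set.Ioo a b, f s ≤ max (f a) (f b))
    (s : α) : ∃ t ∈ T, f s ≤ f t := by
  rcases (T ∩ Set.Iic s).eq_empty_or_nonempty with hl | hl
  · obtain ⟨t, ht, htl⟩ := Set.exists_min_image T id hT hne
    have hs : s ∈ lowerBounds T := fun x hx =>
      (not_le.1 fun hxs => Set.notMem_empty x (hl ▸ ⟨hx, hxs⟩)).le
    exact ⟨t, ht, hmono hs htl (hs ht)⟩
  rcases (T ∩ Set.Ici s).eq_empty_or_nonempty with hr | hr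
  · obtain ⟨t, ht, htu⟩ := Set.exists_max_image T id hT hne
    have hs : s ∈ upperBounds T := fun x hx =>
      (not_le.1 fun hxs => Set.notMem_empty x (hr ▸ ⟨hx, hxs⟩)).le
    exact ⟨t, ht, hanti htu hs (hs ht)⟩
  obtain ⟨a, ⟨haT, has⟩, ha⟩ := Set.exists_max_image _ id (hT.inter_of_left _) hl
  obtain ⟨b, ⟨hbT, hsb⟩, hb⟩ := Set.exists_min_image _ id (hT.inter_of_left _) hr
  rcases (Set.mem_Iic.1 has).eq_or_lt with rfl | has
  · exact ⟨a, haT, le_rfl⟩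
  rcases (Set.mem_Ici.1 hsb).eq_or_lt with rfl | hsb
  · exact ⟨s, hbT, le_rfl⟩
  have hdisj : Disjoint (Set.Ioo a b) T := Set.disjoint_left.2 fun x hx hxT =>
    (le_total x s).elim (fun h => hx.1.not_ge (ha x ⟨hxT, h⟩)) fun h => hx.2.not_ge (hb x ⟨hxT, h⟩)
  rcases le_max_iff.1 (hgap a haT b hbT hdisj s ⟨has, hsb⟩) with h | h
  exacts [⟨a, haT, h⟩, ⟨b, hbT, h⟩]

section DualValue

variable {m : ℕ} {γ : Fin (m + 1) → ℝ} {p : Fin (m + 1) → Fin 2 → Fin 2 → ℝ} {α α' : ℝ}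
  {d : Fin 2}

/-- The constraints that the model imposes on a conditional law of outcome and treatment given the
instrument: nonnegativity, normalisation, and the instrumental inequality. -/
structure Compatible (p : Fin (m + 1) → Fin 2 → Fin 2 → ℝ) : Prop where
  nonneg : 0 ≤ p
  sum_eq_one : ∀ z, ∑ d, ∑ i, p i d z = 1
  sum_max_le_one : ∀ d, ∑ i, max (p i d 0) (p i d 1) ≤ 1

theorem compatible_obs {q : Latent m → ℝ} (hq : q ∈ stdSimplex ℝ (Latent m)) :
    Compatible (obs q) := by
  have obs_apply (i d z) : obs q i d z = ∑ k, q k * column k i d z := by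
    simp [obs, Finset.sum_apply]
  refine ⟨fun i d z => ?_, fun z => ?_, fun d => ?_⟩
  · rw [obs_apply]
    exact Finset.sum_nonneg fun k _ => mul_nonneg (hq.1 k) (by unfold column; split_ifs <;> simp)
  · simp_rw [obs_apply, Finset.sum_comm (t := (Finset.univ : Finset (Latent m))), ← Finset.mul_sum]
    simp [column, ite_and, hq.2]
  · calc ∑ i, max (obs q i d 0) (obs q i d 1)
        ≤ ∑ i, ∑ k : Latent m, q k * if k.1 d = i then 1 else 0 := by
          have column_le (k : Latent m) (i z) : column k i d z ≤ if k.1 d = i then 1 else 0 := by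
            unfold column
            split_ifs with h h'
            exacts [le_rfl, absurd (h.2 ▸ h.1) h', zero_le_one, le_rfl]
          refine Finset.sum_le_sum fun i _ => max_le ?_ ?_ <;> rw [obs_apply]
          all_goals exact Finset.sum_le_sum fun k _ =>
            mul_le_mul_of_nonneg_left (column_le k i _) (hq.1 k)
      _ = 1 := by
          rw [Finset.sum_comm]
          simp [hq.2]

/-- The contribution of treatment `d` to `dualValue`. -/
noncomputable def branchValue (γ : Fin (m + 1) → ℝ) (p : Fin (m + 1) → Fin 2 → Fin 2 → ℝ)
    (d : Fin 2) (α : ℝ) : ℝ :=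
  ∑ i, (∑ z, envelope γ α i d z * p i d z - min (p i d 0) (p i d 1) * max (slack γ α i d) 0)

/-- The optimal value of the dual program when `α` is held fixed. -/
noncomputable def dualValue (γ : Fin (m + 1) → ℝ) (p : Fin (m + 1) → Fin 2 → Fin 2 → ℝ)
    (α : ℝ) : ℝ :=
  ∑ d, branchValue γ p d α

theorem pairing_eq_sum_branch (v p : Fin (m + 1) → Fin 2 → Fin 2 → ℝ) :
    pairing v p = ∑ d, ∑ i, ∑ z, v i d z * p i d z :=
  Finset.sum_comm

theorem Compatible.pairing_smul_tilt (hp : Compatible p) (c : ℝ) : pairing (c • tilt m) p = 0 := by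
  have h₀ := hp.sum_eq_one 0
  have h₁ := hp.sum_eq_one 1
  simp only [Fin.sum_univ_two] at h₀ h₁
  simp only [pairing_eq_sum_branch, tilt, Pi.smul_apply, smul_eq_mul, Fin.sum_univ_two,
    Finset.sum_add_distrib, ← Finset.mul_sum]
  simp only [if_true, one_ne_zero, if_false, mul_neg, neg_mul, mul_one]
  linear_combination c * h₀ - c * h₁

theorem DualFeasible.exists_add_smul_tilt_le (hγ : Monotone γ)
    {u : Fin (m + 1) → Fin 2 → Fin 2 → ℝ} (hu : DualFeasible γ u) :
    ∃ α c : ℝ, u + c • tilt m ≤ envelope γ α := by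
  obtain ⟨-, cross⟩ := (dualFeasible_iff hγ).1 hu
  let M (z : Fin 2) : ℝ := Finset.univ.sup' Finset.univ_nonempty fun a => u a 0 z + γ a
  have zero_le (a z) : u a 0 z + γ a ≤ M z :=
    Finset.le_sup' (fun a => u a 0 z + γ a) (Finset.mem_univ a)
  have one_le (b z) : u b 1 (1 - z) ≤ γ b - M z :=
    le_sub_comm.1 (Finset.sup'_le _ _ fun a _ => by linarith [cross a b z])
  refine ⟨-M 0 - M 1, M 1, fun i d z => ?_⟩
  simp only [Pi.add_apply, Pi.smul_apply, smul_eq_mul, tilt, envelope]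
  match d, z with
  | 0, 0 => rw [if_pos rfl, if_pos rfl, effectSign_zero]; linarith [zero_le i 0]
  | 0, 1 => rw [if_neg one_ne_zero, if_neg one_ne_zero, effectSign_zero]; linarith [zero_le i 1]
  | 1, 0 =>
    have h : u i 1 0 ≤ γ i - M 1 := one_le i 1
    rw [if_pos rfl, if_neg zero_ne_one, effectSign_one]
    linarith
  | 1, 1 =>
    have h : u i 1 1 ≤ γ i - M 0 := one_le i 0
    rw [if_neg one_ne_zero, if_pos rfl, effectSign_one]
    linarith

theorem mul_add_mul_le_sub_min_mul_max {R : Type*} [CommRing R] [LinearOrder R]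
    [IsStrictOrderedRing R] {p₀ p₁ x₀ x₁ X₀ X₁ S : R} (hp₀ : 0 ≤ p₀) (hp₁ : 0 ≤ p₁)
    (hx₀ : x₀ ≤ X₀) (hx₁ : x₁ ≤ X₁) (hx : S ≤ X₀ + X₁ - (x₀ + x₁)) :
    x₀ * p₀ + x₁ * p₁ ≤ X₀ * p₀ + X₁ * p₁ - min p₀ p₁ * max S 0 := by
  have hmax : max S 0 ≤ (X₀ - x₀) + (X₁ - x₁) := max_le (by linarith) (by linarith)
  have hmin := mul_le_mul_of_nonneg_left hmax (le_min hp₀ hp₁)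
  have h₀ := mul_le_mul_of_nonneg_right (min_le_left p₀ p₁) (sub_nonneg.2 hx₀)
  have h₁ := mul_le_mul_of_nonneg_right (min_le_right p₀ p₁) (sub_nonneg.2 hx₁)
  linarith

theorem DualFeasible.exists_pairing_le_dualValue (hγ : Monotone γ) (hp : Compatible p)
    {u : Fin (m + 1) → Fin 2 → Fin 2 → ℝ} (hu : DualFeasible γ u) :
    ∃ α, pairing u p ≤ dualValue γ p α := by
  obtain ⟨α, c, hle⟩ := hu.exists_add_smul_tilt_le hγ
  refine ⟨α, ?_⟩
  rw [← add_zero (pairing u p), ← hp.pairing_smul_tilt c, ← pairing_add_left,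
    pairing_eq_sum_branch]
  refine Finset.sum_le_sum fun d _ => Finset.sum_le_sum fun i _ => ?_
  have htilt : (c • tilt m) i d 0 + (c • tilt m) i d 1 = 0 := by simp [tilt]
  have hsum := ((dualFeasible_iff hγ).1 hu).1 i d
  have henv := sum_envelope γ α i d
  simp only [Fin.sum_univ_two, Pi.add_apply] at hsum henv ⊢
  exact mul_add_mul_le_sub_min_mul_max (hp.nonneg i d 0) (hp.nonneg i d 1) (hle i d 0) (hle i d 1)
    (by linarith)

theorem branchValue_le (hp : Compatible p) {c : ℝ}
    (hc : ∀ i, c ≤ max (slack γ α' i d) 0 - max (slack γ α i d) 0) :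
    branchValue γ p d α' ≤ branchValue γ p d α + effectSign d * (α' - α) * ∑ i, p i d d -
      c * ∑ i, min (p i d 0) (p i d 1) := by
  have henv (i) : ∑ z, envelope γ α' i d z * p i d z =
      ∑ z, envelope γ α i d z * p i d z + effectSign d * (α' - α) * p i d d := by
    simp_rw [sum_fin_two_eq_add_one_sub _ d, envelope_self, envelope_one_sub]
    ring
  rw [branchValue, branchValue, Finset.mul_sum, Finset.mul_sum, ← Finset.sum_add_distrib,
    ← Finset.sum_sub_distrib]
  refine Finset.sum_le_sum fun i _ => ?_
  rw [henv]
  linarith [mul_le_mul_of_nonneg_right (hc i) (le_min (hp.nonneg i d 0) (hp.nonneg i d 1))]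

theorem slack_eq_add (γ : Fin (m + 1) → ℝ) (α α' : ℝ) (i : Fin (m + 1)) (d : Fin 2) :
    slack γ α' i d = slack γ α i d + effectSign d * (α' - α) := by
  unfold slack
  ring

theorem branchValue_le_of_slack_nonneg (hp : Compatible p) (h : ∀ i, 0 ≤ slack γ α i d) (α' : ℝ) :
    branchValue γ p d α' ≤ branchValue γ p d α +
      effectSign d * (α' - α) * (∑ i, p i d d - ∑ i, min (p i d 0) (p i d 1)) := by
  have hc (i) : effectSign d * (α' - α) ≤ max (slack γ α' i d) 0 - max (slack γ α i d) 0 := by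
    rw [max_eq_left (h i), slack_eq_add γ α α']
    linarith [le_max_left (slack γ α i d + effectSign d * (α' - α)) 0]
  linarith [branchValue_le hp hc]

theorem branchValue_le_of_slack_nonpos (hp : Compatible p) (h : ∀ i, slack γ α i d ≤ 0) (α' : ℝ) :
    branchValue γ p d α' ≤ branchValue γ p d α + effectSign d * (α' - α) * ∑ i, p i d d := by
  have hc (i) : 0 ≤ max (slack γ α' i d) 0 - max (slack γ α i d) 0 := by
    rw [max_eq_right (h i), sub_zero]
    exact le_max_right _ _
  linarith [branchValue_le hp hc]

theorem Compatible.sum_sub_sum_min_le (hp : Compatible p) (d : Fin 2) :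
    ∑ i, p i d d - ∑ i, min (p i d 0) (p i d 1) ≤ ∑ i, p i (1 - d) (1 - d) := by
  have hone := hp.sum_eq_one (1 - d)
  have hadd : ∑ i, min (p i d 0) (p i d 1) + ∑ i, max (p i d 0) (p i d 1) =
      ∑ i, p i d d + ∑ i, p i d (1 - d) := by
    rw [← Finset.sum_add_distrib, ← Finset.sum_add_distrib]
    exact Finset.sum_congr rfl fun i _ => by
      rw [min_add_max, ← Fin.sum_univ_two (p i d), sum_fin_two_eq_add_one_sub]
  rw [sum_fin_two_eq_add_one_sub _ d] at hone
  linarith [hp.sum_max_le_one d]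

/-- Here `α` lies beyond every zero of a slack and `α'` lies further out; the sign of the slope out
there is the instrumental inequality. -/
theorem dualValue_le_of_slack (hp : Compatible p) (hd : ∀ i, 0 ≤ slack γ α i d)
    (hd' : ∀ i, slack γ α i (1 - d) ≤ 0) (hα : 0 ≤ effectSign d * (α' - α)) :
    dualValue γ p α' ≤ dualValue γ p α := by
  have h := branchValue_le_of_slack_nonneg hp hd α'
  have h' := branchValue_le_of_slack_nonpos hp hd' α'
  rw [effectSign_one_sub] at h'
  rw [dualValue, dualValue, sum_fin_two_eq_add_one_sub _ d, sum_fin_two_eq_add_one_sub _ d]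
  linarith [mul_le_mul_of_nonneg_left (hp.sum_sub_sum_min_le d) hα]

theorem Compatible.sum_min_le (hp : Compatible p) {z : Fin 2}
    (hz : ∀ i, p i d z ≤ min (p i d 0) (p i d 1)) :
    ∑ i, p i d d + ∑ i, min (p i (1 - d) 0) (p i (1 - d) 1) ≤
      ∑ i, p i (1 - d) (1 - d) + ∑ i, min (p i d 0) (p i d 1) := by
  have hmin (d e) : ∑ i, min (p i d 0) (p i d 1) ≤ ∑ i, p i d e :=
    Finset.sum_le_sum fun i _ => match e with
      | 0 => min_le_left _ _
      | 1 => min_le_right _ _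
  have hle := Finset.sum_le_sum fun i (_ : i ∈ Finset.univ) => hz i
  have hone (z) := hp.sum_eq_one z
  simp_rw [sum_fin_two_eq_add_one_sub _ d] at hone
  obtain rfl | rfl : z = d ∨ z = 1 - d := by omega
  · linarith [hmin (1 - z) (1 - z)]
  · linarith [hmin (1 - d) d, hone d, hone (1 - d)]

theorem slack_centralShift_nonneg (hγ : Monotone γ) (i : Fin (m + 1)) (d : Fin 2) :
    0 ≤ slack γ (centralShift γ) i d := by
  match d with
  | 0 => rw [slack_zero, centralShift]; linarith [hγ (Fin.le_last i)]
  | 1 => rw [slack_one, centralShift]; linarith [hγ (Fin.zero_le i)]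

theorem dualValue_le_centralShift (hγ : Monotone γ) (hp : Compatible p) {z : Fin 2}
    (hz : ∀ i, p i d z ≤ min (p i d 0) (p i d 1))
    (hα : 0 ≤ effectSign d * (α - centralShift γ)) :
    dualValue γ p α ≤ dualValue γ p (centralShift γ) := by
  have h (d) := branchValue_le_of_slack_nonneg hp (slack_centralShift_nonneg hγ · d) α
  have h' := h (1 - d)
  rw [effectSign_one_sub] at h'
  rw [dualValue, dualValue, sum_fin_two_eq_add_one_sub _ d, sum_fin_two_eq_add_one_sub _ d]
  linarith [h d, mul_le_mul_of_nonneg_left (hp.sum_min_le hz) hα]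

theorem max_zero_add_of_mul_nonneg {R : Type*} [CommRing R] [LinearOrder R]
    [IsStrictOrderedRing R] {x y a b : R} (ha : 0 ≤ a) (hb : 0 ≤ b) (hxy : 0 ≤ x * y) :
    max (a * x + b * y) 0 = a * max x 0 + b * max y 0 := by
  rcases mul_nonneg_iff.1 hxy with ⟨hx, hy⟩ | ⟨hx, hy⟩
  · rw [max_eq_left hx, max_eq_left hy, max_eq_left (by positivity)]
  · rw [max_eq_right hx, max_eq_right hy, max_eq_right]
    · simp
    · linarith [mul_nonneg ha (neg_nonneg.2 hx), mul_nonneg hb (neg_nonneg.2 hy)]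

/-- The value of `α` at which the slack of outcome `i` and treatment `d` vanishes. -/
def breakpoint (γ : Fin (m + 1) → ℝ) (i : Fin (m + 1)) (d : Fin 2) : ℝ :=
  -γ i - γ (worstIndex m d)

/-- The values of `α` at which `dualValue` may change its slope. -/
def breakpoints (γ : Fin (m + 1) → ℝ) : Set ℝ :=
  Set.range fun x : Fin (m + 1) × Fin 2 => breakpoint γ x.1 x.2

theorem breakpoint_mem_breakpoints (γ : Fin (m + 1) → ℝ) (i : Fin (m + 1)) (d : Fin 2) :
    breakpoint γ i d ∈ breakpoints γ :=
  ⟨(i, d), rfl⟩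

theorem slack_eq_mul_sub_breakpoint (γ : Fin (m + 1) → ℝ) (α : ℝ) (i : Fin (m + 1))
    (d : Fin 2) : slack γ α i d = effectSign d * (α - breakpoint γ i d) := by
  rw [slack, breakpoint]
  ring

theorem slack_mul_slack_nonneg {a b : ℝ} (hle : a ≤ b)
    (hab : Disjoint (Set.Ioo a b) (breakpoints γ)) (i : Fin (m + 1)) (d : Fin 2) :
    0 ≤ slack γ a i d * slack γ b i d := by
  have hmul : slack γ a i d * slack γ b i d =
      (a - breakpoint γ i d) * (b - breakpoint γ i d) := by
    rw [slack_eq_mul_sub_breakpoint, slack_eq_mul_sub_breakpoint]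
    linear_combination
      (a - breakpoint γ i d) * (b - breakpoint γ i d) * effectSign_mul_self d
  rw [hmul]
  by_contra! hneg
  refine Set.disjoint_right.1 hab (breakpoint_mem_breakpoints γ i d) ?_
  rcases mul_neg_iff.1 hneg with h | h <;> constructor <;> linarith

theorem dualValue_le_max {a b s : ℝ} (hab : Disjoint (Set.Ioo a b) (breakpoints γ))
    (hs : s ∈ Set.Ioo a b) : dualValue γ p s ≤ max (dualValue γ p a) (dualValue γ p b) := by
  have has := sub_pos.2 hs.1
  have hsb := sub_pos.2 hs.2
  have hmax (i d) : (b - a) * max (slack γ s i d) 0 =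
      (b - s) * max (slack γ a i d) 0 + (s - a) * max (slack γ b i d) 0 := by
    rw [← max_zero_add_of_mul_nonneg hsb.le has.le
      (slack_mul_slack_nonneg (hs.1.trans hs.2).le hab i d),
      mul_max_of_nonneg _ _ (by linarith), mul_zero]
    congr 1
    unfold slack
    ring
  have haffine : (b - a) * dualValue γ p s =
      (b - s) * dualValue γ p a + (s - a) * dualValue γ p b := by
    simp only [dualValue, branchValue, Finset.mul_sum, ← Finset.sum_add_distrib]
    refine Finset.sum_congr rfl fun d _ => Finset.sum_congr rfl fun i _ => ?_
    have henv : (b - a) * ∑ z, envelope γ s i d z * p i d z =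
        (b - s) * ∑ z, envelope γ a i d z * p i d z +
          (s - a) * ∑ z, envelope γ b i d z * p i d z := by
      simp_rw [sum_fin_two_eq_add_one_sub _ d, envelope_self, envelope_one_sub]
      ring
    linear_combination henv - min (p i d 0) (p i d 1) * hmax i d
  by_contra! hlt
  obtain ⟨hlta, hltb⟩ := max_lt_iff.1 hlt
  linarith [mul_lt_mul_of_pos_left hlta hsb, mul_lt_mul_of_pos_left hltb has]

theorem exists_breakpoint_dualValue_le (γ : Fin (m + 1) → ℝ) (hp : Compatible p) (s : ℝ) :
    ∃ i d, dualValue γ p s ≤ dualValue γ p (breakpoint γ i d) := by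
  suffices h : ∃ t ∈ breakpoints γ, dualValue γ p s ≤ dualValue γ p t by
    obtain ⟨_, ⟨x, rfl⟩, hx⟩ := h
    exact ⟨x.1, x.2, hx⟩
  have hmem := breakpoint_mem_breakpoints γ
  refine exists_le_of_monotoneOn_of_antitoneOn (Set.finite_range _) (Set.range_nonempty _)
    (fun a _ b hb hab => ?_) (fun a ha b _ hab => ?_)
    (fun a _ b _ hab s hs => dualValue_le_max hab hs) s
  · refine dualValue_le_of_slack (d := 0) hp (fun i => ?_) (fun i => ?_) ?_
    · rw [slack_eq_mul_sub_breakpoint, effectSign_zero]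
      linarith [hb (hmem i 0)]
    · rw [slack_eq_mul_sub_breakpoint, sub_zero, effectSign_one]
      linarith [hb (hmem i 1)]
    · rw [effectSign_zero]
      linarith
  · refine dualValue_le_of_slack (d := 1) hp (fun i => ?_) (fun i => ?_) ?_
    · rw [slack_eq_mul_sub_breakpoint, effectSign_one]
      linarith [ha (hmem i 1)]
    · rw [slack_eq_mul_sub_breakpoint, sub_self, effectSign_zero]
      linarith [ha (hmem i 0)]
    · rw [effectSign_one]
      linarith

/-- The signature whose vertex attains `dualValue` at `α`. -/
noncomputable def optimalSignature (γ : Fin (m + 1) → ℝ) (p : Fin (m + 1) → Fin 2 → Fin 2 → ℝ)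
    (α : ℝ) : Fin (m + 1) → Fin 2 → Fin 2 → Bool :=
  fun i d z => decide (slack γ α i d ≤ 0) ||
    if z = 0 then decide (p i d 1 ≤ p i d 0) else decide (p i d 0 < p i d 1)

theorem pairing_vertexMap_optimalSignature (γ : Fin (m + 1) → ℝ)
    (p : Fin (m + 1) → Fin 2 → Fin 2 → ℝ) (α : ℝ) :
    pairing (vertexMap γ α (optimalSignature γ p α)) p = dualValue γ p α := by
  rw [pairing_eq_sum_branch, dualValue]
  refine Finset.sum_congr rfl fun d _ => Finset.sum_congr rfl fun i _ => ?_
  simp only [vertexMap_eq_envelope_sub, sub_mul, Finset.sum_sub_distrib]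
  congr 1
  rcases le_or_gt (slack γ α i d) 0 with hs | hs
  · simp [optimalSignature, hs]
  · rw [max_eq_left hs.le]
    rcases le_or_gt (p i d 1) (p i d 0) with hp | hp
    · simp [optimalSignature, hs.not_ge, hp, hp.not_gt, mul_comm]
    · simp [optimalSignature, hs.not_ge, hp, hp.not_ge, hp.le, mul_comm]

theorem optimalSignature_status (γ : Fin (m + 1) → ℝ) (p : Fin (m + 1) → Fin 2 → Fin 2 → ℝ)
    (α : ℝ) (i : Fin (m + 1)) (d : Fin 2) :
    (∀ z, optimalSignature γ p α i d z = true) ∧ slack γ α i d ≤ 0 ∨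
      optimalSignature γ p α i d 0 ≠ optimalSignature γ p α i d 1 ∧ 0 ≤ slack γ α i d := by
  rcases le_or_gt (slack γ α i d) 0 with hs | hs
  · exact Or.inl ⟨by simp [optimalSignature, hs], hs⟩
  · exact Or.inr ⟨by simp [optimalSignature, hs.not_ge, ← not_le], hs.le⟩

theorem le_min_of_optimalSignature_eq_false {i : Fin (m + 1)} {d z : Fin 2}
    (h : optimalSignature γ p α i d z = false) : p i d z ≤ min (p i d 0) (p i d 1) := by
  match z with
  | 0 =>
    have : p i d 0 < p i d 1 := by simp_all [optimalSignature]
    exact le_min le_rfl this.le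
  | 1 =>
    have : p i d 1 ≤ p i d 0 := by simp_all [optimalSignature]
    exact le_min this le_rfl

theorem exists_true_optimalSignature (hγ : Monotone γ) (hp : Compatible p)
    (hα : dualValue γ p (centralShift γ) < dualValue γ p α ∨ α = centralShift γ) (d z : Fin 2) :
    ∃ i, optimalSignature γ p α i d z = true := by
  by_contra! hfalse
  simp only [ne_eq, Bool.not_eq_true] at hfalse
  have hs : 0 < effectSign d * (α - centralShift γ) := by
    have hworst := hfalse (worstIndex m (1 - d))
    rw [← slack_worstIndex]
    by_contra! hs
    simp [optimalSignature, hs] at hworst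
  rcases hα with hα | rfl
  · exact hα.not_ge
      (dualValue_le_centralShift hγ hp (fun i => le_min_of_optimalSignature_eq_false (hfalse i))
        hs.le)
  · simp at hs

theorem admissible_optimalSignature (hγ : Monotone γ) (hp : Compatible p)
    (hα : dualValue γ p (centralShift γ) < dualValue γ p α ∨ α = centralShift γ)
    {i : Fin (m + 1)} (hs : slack γ α i d = 0) : Admissible γ α (optimalSignature γ p α) where
  status := optimalSignature_status γ p α
  exists_true := exists_true_optimalSignature hγ hp hα
  tight := ⟨i, d, by simp [optimalSignature, hs], hs⟩

theorem DualFeasible.exists_mem_vertexSet_pairing_le (hγ : StrictMono γ) (hp : Compatible p)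
    {u : Fin (m + 1) → Fin 2 → Fin 2 → ℝ} (hu : DualFeasible γ u) :
    ∃ v ∈ vertexSet γ, pairing u p ≤ pairing v p := by
  obtain ⟨s, hs⟩ := hu.exists_pairing_le_dualValue hγ.monotone hp
  obtain ⟨i, d, ht⟩ := exists_breakpoint_dualValue_le γ hp s
  have hcentral : slack γ (centralShift γ) (worstIndex m (1 - 0)) 0 = 0 := by
    rw [slack_worstIndex, sub_self, mul_zero]
  have hbreak : slack γ (breakpoint γ i d) i d = 0 := by
    rw [slack_eq_mul_sub_breakpoint, sub_self, mul_zero]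
  rcases le_or_gt (dualValue γ p (breakpoint γ i d)) (dualValue γ p (centralShift γ)) with h | h
  · refine ⟨_, (admissible_optimalSignature (p := p) hγ.monotone hp (Or.inr rfl)
      hcentral).vertexMap_mem_vertexSet hγ, ?_⟩
    rw [pairing_vertexMap_optimalSignature]
    exact hs.trans (ht.trans h)
  · refine ⟨_, (admissible_optimalSignature hγ.monotone hp (Or.inl h)
      hbreak).vertexMap_mem_vertexSet hγ, ?_⟩
    rw [pairing_vertexMap_optimalSignature]
    exact hs.trans ht

end DualValue

/-! ### Strong duality and irredundancy -/

section Duality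

variable {E : Type*} [AddCommGroup E] [Module ℝ E] [TopologicalSpace E]
  [IsTopologicalAddGroup E] [ContinuousSMul ℝ E] [LocallyConvexSpace ℝ E]

theorem exists_strongDual_add_le_snd_of_notMem {S : Set (E × ℝ)} (hS : Convex ℝ S)
    (hclosed : IsClosed S) {x : E} {s t : ℝ} (hs : (x, s) ∈ S) (ht : (x, t) ∉ S) (hts : t ≤ s) :
    ∃ (g : StrongDual ℝ E) (r : ℝ), (∀ y ∈ S, g y.1 + r ≤ y.2) ∧ t < g x + r := by
  obtain ⟨f, b, hfb, hbf⟩ := geometric_hahn_banach_closed_point hS hclosed ht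
  have f_apply (y : E × ℝ) : f y = f (y.1, 0) + y.2 * f (0, 1) := by
    rw [← smul_eq_mul, ← map_smul, ← map_add]
    simp
  have hslope : f (0, 1) < 0 := by
    have := hfb _ hs
    rw [f_apply] at this hbf
    by_contra! h
    linarith [mul_le_mul_of_nonneg_right hts h]
  have normalized_apply (y : E) :
      (-(f (0, 1))⁻¹ • f.comp (.inl ℝ E ℝ)) y + b / f (0, 1) = (b - f (y, 0)) / f (0, 1) := by
    simp only [smul_apply, smul_eq_mul, ContinuousLinearMap.comp_apply,
      ContinuousLinearMap.inl_apply]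
    ring
  refine ⟨-(f (0, 1))⁻¹ • f.comp (.inl ℝ E ℝ), b / f (0, 1), fun y hy => ?_, ?_⟩
  · rw [normalized_apply, div_le_iff_of_neg hslope]
    linarith [hfb y hy, f_apply y]
  · rw [normalized_apply, lt_div_iff_of_neg hslope]
    linarith [f_apply (x, t)]

theorem exists_stdSimplex_sum_smul_eq [T2Space E] {K : Type*} [Fintype K] (A : K → E) (c : K → ℝ)
    {q₀ : K → ℝ} (hq₀ : q₀ ∈ stdSimplex ℝ K) {v : ℝ} (hv : v ≤ ∑ k, q₀ k * c k)
    (hdual : ∀ (g : StrongDual ℝ E) (r : ℝ), (∀ k, g (A k) + r ≤ c k) →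
      g (∑ k, q₀ k • A k) + r ≤ v) :
    ∃ q ∈ stdSimplex ℝ K, ∑ k, q k • A k = ∑ k, q₀ k • A k ∧ ∑ k, q k * c k = v := by
  classical
  let F : (K → ℝ) →ₗ[ℝ] E × ℝ :=
    (Fintype.linearCombination ℝ A).prod (Fintype.linearCombination ℝ c)
  have F_apply (q : K → ℝ) : F q = (∑ k, q k • A k, ∑ k, q k * c k) := rfl
  suffices h : (∑ k, q₀ k • A k, v) ∈ F '' stdSimplex ℝ K by
    obtain ⟨q, hq, hqv⟩ := h
    exact ⟨q, hq, Prod.mk.inj (F_apply q ▸ hqv)⟩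
  by_contra hnot
  have hclosed : IsClosed (F '' stdSimplex ℝ K) :=
    ((isCompact_stdSimplex ℝ K).image F.continuous_of_finiteDimensional).isClosed
  obtain ⟨g, r, hle, hlt⟩ := exists_strongDual_add_le_snd_of_notMem
    ((convex_stdSimplex ℝ K).linear_image F) hclosed ⟨q₀, hq₀, F_apply q₀⟩ hnot hv
  refine (hdual g r fun k => ?_).not_gt hlt
  simpa [F_apply, Pi.single_apply] using hle _ ⟨_, single_mem_stdSimplex ℝ k, rfl⟩

theorem exists_mem_stdSimplex_ne_zero_iff {K : Type*} [Fintype K] {S : Set K} (hS : S.Nonempty) :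
    ∃ q ∈ stdSimplex ℝ K, ∀ k, q k ≠ 0 ↔ k ∈ S := by
  classical
  lift S to Finset K using S.toFinite
  have hcard : (S.card : ℝ) ≠ 0 := Nat.cast_ne_zero.2 (Finset.coe_nonempty.1 hS).card_ne_zero
  refine ⟨fun k => if k ∈ S then (S.card : ℝ)⁻¹ else 0, ⟨fun k => ?_, ?_⟩, fun k => ?_⟩
  · dsimp only
    positivity
  · simp [hcard]
  · simp [hcard]

end Duality

section Program

variable {m : ℕ} {γ : Fin (m + 1) → ℝ} {q : Latent m → ℝ}

theorem exists_pairing_eq_add (f : (Fin (m + 1) → Fin 2 → Fin 2 → ℝ) →ₗ[ℝ] ℝ) (r : ℝ) :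
    ∃ u, ∀ p, ∑ d, ∑ i, p i d 0 = 1 → pairing u p = f p + r := by
  let basis (i : Fin (m + 1)) (d z : Fin 2) : Fin (m + 1) → Fin 2 → Fin 2 → ℝ :=
    Pi.single i (Pi.single d (Pi.single z 1))
  refine ⟨(fun i d z => f (basis i d z)) + fun _ _ z => if z = 0 then r else 0, fun p hp => ?_⟩
  rw [pairing_add_left]
  congr 1
  · have hexpand : p = ∑ i, ∑ d, ∑ z, p i d z • basis i d z := by
      ext i d z
      fin_cases d <;> fin_cases z <;>
        simp [basis, Finset.sum_apply, Pi.single_apply, ite_apply]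
    conv_rhs => rw [hexpand]
    simp only [pairing, map_sum, map_smul, smul_eq_mul, mul_comm]
  · rw [pairing_eq_sum_branch]
    simp [← Finset.mul_sum, hp]

/-- The average treatment effect in a population with the weights `q` on the latent types. -/
def averageEffect (γ : Fin (m + 1) → ℝ) (q : Latent m → ℝ) : ℝ := ∑ k, q k * effect γ k

theorem DualFeasible.pairing_obs_le {u : Fin (m + 1) → Fin 2 → Fin 2 → ℝ} (hu : DualFeasible γ u)
    (hq : 0 ≤ q) : pairing u (obs q) ≤ averageEffect γ q := by
  rw [pairing_obs]
  exact Finset.sum_le_sum fun k _ => mul_le_mul_of_nonneg_left (hu k) (hq k)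

theorem DualFeasible.pairing_obs_eq_iff {u : Fin (m + 1) → Fin 2 → Fin 2 → ℝ}
    (hu : DualFeasible γ u) (hq : 0 ≤ q) :
    pairing u (obs q) = averageEffect γ q ↔
      ∀ k, q k ≠ 0 → pairing u (column k) = effect γ k := by
  rw [pairing_obs, averageEffect, Finset.sum_eq_sum_iff_of_le fun k _ =>
    mul_le_mul_of_nonneg_left (hu k) (hq k)]
  simp only [Finset.mem_univ, true_imp_iff, mul_eq_mul_left_iff, or_iff_not_imp_right, ne_eq]

theorem dualFeasible_of_mem_vertexSet (hγ : Monotone γ) {v : Fin (m + 1) → Fin 2 → Fin 2 → ℝ}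
    (hv : v ∈ vertexSet γ) : DualFeasible γ v := by
  obtain ⟨α, B, h, rfl⟩ := exists_admissible_of_mem_vertexSet hγ hv
  exact h.dualFeasible hγ

theorem vertexMax_obs_le_averageEffect (hγ : Monotone γ) (hq : 0 ≤ q) :
    vertexMax γ (obs q) ≤ averageEffect γ q :=
  Finset.sup'_le _ _ fun _ hv =>
    (dualFeasible_of_mem_vertexSet hγ ((vertexSet_finite γ).mem_toFinset.1 hv)).pairing_obs_le hq

theorem exists_obs_eq_and_averageEffect_eq_vertexMax (hγ : StrictMono γ)
    (hq : q ∈ stdSimplex ℝ (Latent m)) :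
    ∃ q' ∈ stdSimplex ℝ (Latent m), obs q' = obs q ∧
      averageEffect γ q' = vertexMax γ (obs q) := by
  refine exists_stdSimplex_sum_smul_eq column (effect γ) hq
    (vertexMax_obs_le_averageEffect hγ.monotone hq.1) fun f r hf => ?_
  obtain ⟨u, hu⟩ := exists_pairing_eq_add f.toLinearMap r
  have compatible_column (k : Latent m) : Compatible (column k) := by
    classical
    simpa [obs, Pi.single_apply] using compatible_obs (single_mem_stdSimplex ℝ k)
  have hfeas : DualFeasible γ u := fun k =>
    (hu _ ((compatible_column k).sum_eq_one 0)).trans_le (hf k)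
  obtain ⟨v, hv, hle⟩ := hfeas.exists_mem_vertexSet_pairing_le hγ (compatible_obs hq)
  exact (hu _ ((compatible_obs hq).sum_eq_one 0)).symm.trans_le <|
    hle.trans (Finset.le_sup' (pairing · (obs q)) ((vertexSet_finite γ).mem_toFinset.2 hv))

theorem exists_forall_pairing_obs_lt (hγ : Monotone γ) {v : Fin (m + 1) → Fin 2 → Fin 2 → ℝ}
    (hv : v ∈ vertexSet γ) :
    ∃ q ∈ stdSimplex ℝ (Latent m),
      ∀ w ∈ vertexSet γ, w ≠ v → pairing w (obs q) < pairing v (obs q) := by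
  have hv_feas := dualFeasible_of_mem_vertexSet hγ hv
  obtain ⟨α, B, h, rfl⟩ := exists_admissible_of_mem_vertexSet hγ hv
  have hne : {k | pairing (vertexMap γ α B) (column k) = effect γ k}.Nonempty := by
    obtain ⟨i, d, hB, hs⟩ := h.tight
    refine ⟨nonresponder d i, ?_⟩
    rw [Set.mem_ofPred_eq, pairing_column_nonresponder, effect_nonresponder,
      sum_vertexMap_of_forall_true hB, hs, add_zero]
  obtain ⟨q, hq, hsupport⟩ := exists_mem_stdSimplex_ne_zero_iff hne
  refine ⟨q, hq, fun w hw hwv => ?_⟩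
  rw [(hv_feas.pairing_obs_eq_iff hq.1).2 fun k => (hsupport k).1]
  have hw_feas := dualFeasible_of_mem_vertexSet hγ hw
  refine (hw_feas.pairing_obs_le hq.1).lt_of_ne fun heq => hwv ?_
  obtain ⟨α', B', h', rfl⟩ := exists_admissible_of_mem_vertexSet hγ hw
  exact h.vertexMap_eq_of_tight h' fun k hk =>
    (hw_feas.pairing_obs_eq_iff hq.1).1 heq k ((hsupport k).2 hk)

end Program

section Conjugation

variable {m : ℕ} {γ : Fin (m + 1) → ℝ} {q : Latent m → ℝ}

/-- The latent type after exchanging the two treatment labels. -/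
def swapTreatment (k : Latent m) : Latent m := (fun d => k.1 (1 - d), fun z => 1 - k.2 z)

theorem swapTreatment_involutive : Function.Involutive (swapTreatment (m := m)) := fun k => by
  simp [swapTreatment]

theorem comp_swapTreatment_comp_swapTreatment (q : Latent m → ℝ) :
    (q ∘ swapTreatment) ∘ swapTreatment = q := by
  rw [Function.comp_assoc, swapTreatment_involutive.comp_self, Function.comp_id]

theorem comp_swapTreatment_mem_stdSimplex (hq : q ∈ stdSimplex ℝ (Latent m)) :
    q ∘ swapTreatment ∈ stdSimplex ℝ (Latent m) :=
  ⟨fun _ => hq.1 _, (swapTreatment_involutive.bijective.sum_comp q).trans hq.2⟩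

theorem averageEffect_comp_swapTreatment (γ : Fin (m + 1) → ℝ) (q : Latent m → ℝ) :
    averageEffect γ (q ∘ swapTreatment) = -averageEffect γ q := by
  have effect_swapTreatment (k : Latent m) : effect γ (swapTreatment k) = -effect γ k := by
    simp [effect, swapTreatment]
  rw [averageEffect, averageEffect, ← Finset.sum_neg_distrib,
    ← swapTreatment_involutive.bijective.sum_comp]
  simp only [Function.comp_apply, swapTreatment_involutive _, effect_swapTreatment, mul_neg]

theorem obs_comp_swapTreatment (q : Latent m → ℝ) :
    obs (q ∘ swapTreatment) = fun i d z => obs q i (1 - d) z := by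
  have column_swapTreatment (k : Latent m) (i d z) :
      column (swapTreatment k) i d z = column k i (1 - d) z := by
    simp only [column, swapTreatment, sub_sub_cancel, sub_eq_iff_eq_add, eq_sub_iff_add_eq,
      eq_comm, add_comm]
  ext i d z
  rw [obs, obs, ← swapTreatment_involutive.bijective.sum_comp]
  simp only [Finset.sum_apply, Pi.smul_apply, Function.comp_apply, swapTreatment_involutive _,
    column_swapTreatment]

theorem averageEffect_le_neg_vertexMax (hγ : Monotone γ) (hq : 0 ≤ q) :
    averageEffect γ q ≤ -vertexMax γ (obs (q ∘ swapTreatment)) := by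
  rw [le_neg, ← averageEffect_comp_swapTreatment]
  exact vertexMax_obs_le_averageEffect hγ fun k => hq (swapTreatment k)

theorem exists_obs_eq_and_averageEffect_eq_neg_vertexMax (hγ : StrictMono γ)
    (hq : q ∈ stdSimplex ℝ (Latent m)) :
    ∃ q' ∈ stdSimplex ℝ (Latent m), obs q' = obs q ∧
      averageEffect γ q' = -vertexMax γ (obs (q ∘ swapTreatment)) := by
  obtain ⟨q', hq', hobs, heff⟩ :=
    exists_obs_eq_and_averageEffect_eq_vertexMax hγ (comp_swapTreatment_mem_stdSimplex hq)
  refine ⟨q' ∘ swapTreatment, comp_swapTreatment_mem_stdSimplex hq', ?_, ?_⟩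
  · rw [obs_comp_swapTreatment, hobs, ← obs_comp_swapTreatment,
      comp_swapTreatment_comp_swapTreatment]
  · rw [averageEffect_comp_swapTreatment, heff]

end Conjugation

/-! ### Models -/

section FiniteMeasure

variable {α : Type*} [Fintype α] [MeasurableSpace α] [MeasurableSingletonClass α]

theorem real_singleton_mem_stdSimplex (ν : Measure α) [IsProbabilityMeasure ν] :
    (fun a => ν.real {a}) ∈ stdSimplex ℝ α :=
  ⟨fun _ => measureReal_nonneg, by
    rw [sum_measureReal_singleton, Finset.coe_univ, probReal_univ]⟩

theorem exists_isProbabilityMeasure_real_singleton_eq {q : α → ℝ} (hq : q ∈ stdSimplex ℝ α) :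
    ∃ ν : Measure α, IsProbabilityMeasure ν ∧ (fun a => ν.real {a}) = q := by
  refine ⟨(PMF.ofFintype (fun a => ENNReal.ofReal (q a)) ?_).toMeasure, inferInstance,
    funext fun a => ?_⟩
  · rw [← ENNReal.ofReal_sum_of_nonneg fun a _ => hq.1 a, hq.2, ENNReal.ofReal_one]
  · rw [Measure.real, PMF.toMeasure_apply_singleton _ _ (measurableSet_singleton a),
      PMF.ofFintype_apply, ENNReal.toReal_ofReal (hq.1 a)]

end FiniteMeasure

section Model

variable {m : ℕ} {γ : Fin (m + 1) → ℝ} {ν : Measure (Latent m)} {ρ : Measure (Fin 2)}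

/-- The joint law of the index of the outcome, the treatment and the instrument when the latent
type and the instrument are independent with laws `ν` and `ρ`. -/
noncomputable def cellLaw (ν : Measure (Latent m)) (ρ : Measure (Fin 2)) :
    Measure (Fin (m + 1) × Fin 2 × Fin 2) :=
  (ν.prod ρ).map fun x => (x.1.1 (x.1.2 x.2), x.1.2 x.2, x.2)

/-- The law of `(Y, D, Z)` when the latent type and the instrument are independent with laws `ν`
and `ρ`. -/
noncomputable def observableLaw (γ : Fin (m + 1) → ℝ) (ν : Measure (Latent m))
    (ρ : Measure (Fin 2)) : Measure (ℝ × Fin 2 × Fin 2) :=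
  (cellLaw ν ρ).map (Prod.map γ id)

theorem observableLaw_eq_map (γ : Fin (m + 1) → ℝ) (ν : Measure (Latent m)) (ρ : Measure (Fin 2)) :
    observableLaw γ ν ρ =
      (ν.prod ρ).map fun x => (γ (x.1.1 (x.1.2 x.2)), x.1.2 x.2, x.2) :=
  Measure.map_map .of_discrete .of_discrete

theorem cellLaw_real_singleton [IsFiniteMeasure ν] [IsFiniteMeasure ρ] (i : Fin (m + 1))
    (d z : Fin 2) :
    (cellLaw ν ρ).real {(i, d, z)} = obs (fun k => ν.real {k}) i d z * ρ.real {z} := by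
  classical
  have hpre : (fun x : Latent m × Fin 2 => (x.1.1 (x.1.2 x.2), x.1.2 x.2, x.2)) ⁻¹' {(i, d, z)} =
      (({k | k.1 (k.2 z) = i ∧ k.2 z = d} : Finset (Latent m)) : Set (Latent m)) ×ˢ {z} := by
    ext ⟨k, z'⟩
    simp only [Set.mem_preimage, Set.mem_singleton_iff, Prod.mk.injEq, Set.mem_prod,
      Finset.coe_filter_univ, Set.mem_ofPred_eq]
    constructor
    · rintro ⟨h, h', rfl⟩
      exact ⟨⟨h, h'⟩, rfl⟩
    · rintro ⟨⟨h, h'⟩, rfl⟩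
      exact ⟨h, h', rfl⟩
  rw [cellLaw, map_measureReal_apply .of_discrete (measurableSet_singleton _), hpre,
    measureReal_prod_prod, ← sum_measureReal_singleton]
  simp [obs, column, Finset.sum_apply, Finset.sum_filter]

theorem cellLaw_real_instrument [IsProbabilityMeasure ν] [IsFiniteMeasure ρ] (z : Fin 2) :
    (cellLaw ν ρ).real {x | x.2.2 = z} = ρ.real {z} := by
  have hpre : (fun x : Latent m × Fin 2 => (x.1.1 (x.1.2 x.2), x.1.2 x.2, x.2)) ⁻¹'
      {x | x.2.2 = z} = Set.univ ×ˢ {z} := by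
    ext x
    simp
  rw [cellLaw, map_measureReal_apply .of_discrete .of_discrete, hpre, measureReal_prod_prod,
    probReal_univ, one_mul]

theorem observableLaw_congr {ν' : Measure (Latent m)} [IsFiniteMeasure ν] [IsFiniteMeasure ν']
    [IsFiniteMeasure ρ] (h : obs (fun k => ν.real {k}) = obs fun k => ν'.real {k}) :
    observableLaw γ ν ρ = observableLaw γ ν' ρ := by
  have (κ : Measure (Latent m)) [IsFiniteMeasure κ] : IsFiniteMeasure (cellLaw κ ρ) :=
    Measure.isFiniteMeasure_map _ _
  rw [observableLaw, observableLaw, Measure.ext_of_singleton (μ := cellLaw ν ρ) fun x => ?_]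
  rw [← measureReal_eq_measureReal_iff, cellLaw_real_singleton, cellLaw_real_singleton, h]

theorem condVec_observableLaw (hγ : Function.Injective γ) [IsProbabilityMeasure ν]
    [IsFiniteMeasure ρ] (hρ : ∀ z, ρ {z} ≠ 0) :
    condVec γ (observableLaw γ ν ρ) = obs fun k => ν.real {k} := by
  ext i d z
  have hinstrument : MeasurableSet {x : ℝ × Fin 2 × Fin 2 | x.2.2 = z} :=
    (measurableSet_singleton z).preimage measurable_snd.snd
  have hcell : MeasurableSet {x : ℝ × Fin 2 × Fin 2 | x.1 = γ i ∧ x.2.1 = d} :=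
    ((measurableSet_singleton (γ i)).preimage measurable_fst).inter
      ((measurableSet_singleton d).preimage measurable_snd.fst)
  have hpre : Prod.map γ id ⁻¹' ({x : ℝ × Fin 2 × Fin 2 | x.2.2 = z} ∩
      {x | x.1 = γ i ∧ x.2.1 = d}) = {(i, d, z)} := by
    ext ⟨j, e, z'⟩
    simp only [Set.mem_preimage, Set.mem_inter_iff, Set.mem_ofPred_eq, Prod.map_apply, id_eq,
      hγ.eq_iff, Set.mem_singleton_iff, Prod.mk.injEq]
    tauto
  have hz : ρ.real {z} ≠ 0 := ENNReal.toReal_ne_zero.2 ⟨hρ z, measure_ne_top ρ _⟩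
  rw [condVec, measureReal_def, cond_apply hinstrument, ENNReal.toReal_mul, ENNReal.toReal_inv,
    ← measureReal_def, ← measureReal_def, observableLaw,
    map_measureReal_apply .of_discrete hinstrument,
    map_measureReal_apply .of_discrete (hinstrument.inter hcell), hpre, cellLaw_real_singleton]
  change ((cellLaw ν ρ).real {x | x.2.2 = z})⁻¹ * _ = _
  rw [cellLaw_real_instrument, mul_comm, mul_inv_cancel_right₀ hz]

theorem conjugateLaw_observableLaw [SFinite ν] [SFinite ρ] :
    conjugateLaw (observableLaw γ ν ρ) = observableLaw γ (ν.map swapTreatment) ρ := by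
  have hconj : Measurable fun x : ℝ × Fin 2 × Fin 2 => (x.1, 1 - x.2.1, x.2.2) :=
    measurable_fst.prodMk
      ((Measurable.of_discrete.comp measurable_snd.fst).prodMk measurable_snd.snd)
  have hprod : (ν.map swapTreatment).prod ρ = (ν.prod ρ).map (Prod.map swapTreatment id) := by
    rw [← Measure.map_prod_map ν ρ .of_discrete measurable_id, Measure.map_id]
  rw [conjugateLaw, observableLaw_eq_map, observableLaw_eq_map, hprod,
    Measure.map_map hconj .of_discrete, Measure.map_map .of_discrete .of_discrete]
  congr 1
  ext x <;> simp [swapTreatment]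

theorem condVec_conjugateLaw_observableLaw (hγ : Function.Injective γ) [IsProbabilityMeasure ν]
    [IsFiniteMeasure ρ] (hρ : ∀ z, ρ {z} ≠ 0) :
    condVec γ (conjugateLaw (observableLaw γ ν ρ)) =
      obs ((fun k => ν.real {k}) ∘ swapTreatment) := by
  have := Measure.isProbabilityMeasure_map (μ := ν) (f := swapTreatment) (by fun_prop)
  rw [conjugateLaw_observableLaw, condVec_observableLaw hγ hρ]
  congr 1
  ext k
  rw [map_measureReal_apply .of_discrete (measurableSet_singleton k),
    ← swapTreatment_involutive.image_eq_preimage_symm, Function.comp_apply, Set.image_singleton]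

theorem integral_effect [IsFiniteMeasure ν] :
    ∫ k, effect γ k ∂ν = averageEffect γ fun k => ν.real {k} :=
  integral_fintype .of_finite

/-- The model on the product of the latent types and the instrument values, in which both
coordinates are read off directly. -/
def canonicalData (γ : Fin (m + 1) → ℝ) : IVData (Latent m × Fin 2) where
  Ypot d _ x := γ (x.1.1 d)
  Dpot z x := x.1.2 z
  Z x := x.2
  D x := x.1.2 x.2
  Y x := γ (x.1.1 (x.1.2 x.2))

theorem isIVModel_canonicalData (γ : Fin (m + 1) → ℝ) [IsProbabilityMeasure ν]
    [IsProbabilityMeasure ρ] (hρ : ∀ z, ρ {z} ≠ 0) :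
    IsIVModel γ (ν.prod ρ) (canonicalData γ) where
  prob := inferInstance
  measurable_Ypot _ _ := .of_discrete
  measurable_Dpot _ := .of_discrete
  measurable_Z := .of_discrete
  measurable_D := .of_discrete
  measurable_Y := .of_discrete
  support _ _ := .of_forall fun _ => Set.mem_range_self _
  instrument_pos z := by
    have : {x | (canonicalData γ).Z x = z} = Set.univ ×ˢ {z} := by
      ext x
      simp [canonicalData]
    rw [this, Measure.prod_prod, measure_univ, one_mul]
    exact hρ z
  exclusion _ _ _ := .rfl
  random_assignment :=
    (indepFun_prod (X := fun k : Latent m => (γ (k.1 0), γ (k.1 1), k.2 0, k.2 1)) (Y := id)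
      .of_discrete measurable_id).symm
  consistency_Y := .of_forall fun x => by
    simp only [canonicalData, IVData.Yd]
    generalize x.1.2 x.2 = d
    fin_cases d <;> simp
  consistency_D := .of_forall fun x => (Fintype.sum_ite_eq x.2 fun z => (x.1.2 z : ℕ)).symm

theorem observedLaw_canonicalData (γ : Fin (m + 1) → ℝ) (ν : Measure (Latent m))
    (ρ : Measure (Fin 2)) :
    (canonicalData γ).observedLaw (ν.prod ρ) = observableLaw γ ν ρ :=
  (observableLaw_eq_map γ ν ρ).symm

theorem ATE_canonicalData (γ : Fin (m + 1) → ℝ) [IsFiniteMeasure ν] [IsProbabilityMeasure ρ] :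
    (canonicalData γ).ATE (ν.prod ρ) = averageEffect γ fun k => ν.real {k} := by
  rw [← integral_effect]
  exact (integral_fun_fst (effect γ)).trans (by simp)

variable {Ω : Type*} [MeasurableSpace Ω] {μ : Measure Ω} {X : IVData Ω}

theorem IsIVModel.observed_ae_eq (h : IsIVModel γ μ X) :
    ∀ᵐ ω ∂μ, X.D ω = X.Dpot (X.Z ω) ω ∧ X.Y ω = X.Yd (X.D ω) ω := by
  filter_upwards [h.consistency_Y, h.consistency_D] with ω hY hD
  refine ⟨Fin.ext (by simpa using hD), hY.trans ?_⟩
  generalize X.D ω = d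
  fin_cases d <;> simp

theorem IsIVModel.exists_latent (h : IsIVModel γ μ X) (hγ : Function.Injective γ) :
    ∃ κ : Ω → Latent m, Measurable κ ∧ IndepFun κ X.Z μ ∧
      ∀ᵐ ω ∂μ, (∀ d, X.Yd d ω = γ ((κ ω).1 d)) ∧ ∀ z, X.Dpot z ω = (κ ω).2 z := by
  have hemb : MeasurableEmbedding γ := Measurable.of_discrete.measurableEmbedding hγ
  let φ : ℝ × ℝ × Fin 2 × Fin 2 → Latent m := fun w =>
    (![hemb.invFun w.1, hemb.invFun w.2.1], ![w.2.2.1, w.2.2.2])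
  have hinv := hemb.measurable_invFun
  have hφ : Measurable φ := by
    refine (measurable_pi_iff.2 fun d => ?_).prodMk (measurable_pi_iff.2 fun z => ?_)
    · fin_cases d
      exacts [hinv.comp measurable_fst, hinv.comp measurable_snd.fst]
    · fin_cases z
      exacts [measurable_snd.snd.fst, measurable_snd.snd.snd]
  have hpotential : Measurable fun ω => (X.Yd 0 ω, X.Yd 1 ω, X.Dpot 0 ω, X.Dpot 1 ω) :=
    (h.measurable_Ypot 0 0).prodMk ((h.measurable_Ypot 1 0).prodMk
      ((h.measurable_Dpot 0).prodMk (h.measurable_Dpot 1)))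
  refine ⟨φ ∘ fun ω => (X.Yd 0 ω, X.Yd 1 ω, X.Dpot 0 ω, X.Dpot 1 ω), hφ.comp hpotential,
    (h.random_assignment.comp measurable_id hφ).symm, ?_⟩
  have hinvFun {y : ℝ} (hy : y ∈ Set.range γ) : y = γ (hemb.invFun y) := by
    obtain ⟨i, rfl⟩ := hy
    rw [hemb.leftInverse_invFun i]
  filter_upwards [h.support 0 0, h.support 1 0] with ω h0 h1
  refine ⟨fun d => ?_, fun z => ?_⟩
  · fin_cases d
    exacts [hinvFun h0, hinvFun h1]
  · fin_cases z <;> rfl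

theorem IsIVModel.exists_observedLaw_eq_and_ATE_eq (h : IsIVModel γ μ X)
    (hγ : Function.Injective γ) :
    ∃ (ν : Measure (Latent m)) (ρ : Measure (Fin 2)), IsProbabilityMeasure ν ∧
      IsProbabilityMeasure ρ ∧ (∀ z, ρ {z} ≠ 0) ∧ X.observedLaw μ = observableLaw γ ν ρ ∧
      X.ATE μ = averageEffect γ fun k => ν.real {k} := by
  have := h.prob
  obtain ⟨κ, hκ, hindep, hlatent⟩ := h.exists_latent hγ
  have hν : IsProbabilityMeasure (μ.map κ) := Measure.isProbabilityMeasure_map hκ.aemeasurable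
  have hρ : IsProbabilityMeasure (μ.map X.Z) :=
    Measure.isProbabilityMeasure_map h.measurable_Z.aemeasurable
  refine ⟨μ.map κ, μ.map X.Z, hν, hρ, fun z => ?_, ?_, ?_⟩
  · rw [Measure.map_apply h.measurable_Z (measurableSet_singleton z)]
    exact h.instrument_pos z
  · rw [observableLaw_eq_map, ← (indepFun_iff_map_prod_eq_prod_map_map hκ.aemeasurable
      h.measurable_Z.aemeasurable).1 hindep,
      Measure.map_map .of_discrete (hκ.prodMk h.measurable_Z)]
    refine Measure.map_congr ?_
    filter_upwards [hlatent, h.observed_ae_eq] with ω ⟨hY, hD⟩ ⟨hDobs, hYobs⟩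
    simp only [Function.comp_apply, ← hY, ← hD, ← hDobs, ← hYobs]
  · rw [← integral_effect, integral_map hκ.aemeasurable (.of_discrete)]
    refine integral_congr_ae ?_
    filter_upwards [hlatent] with ω ⟨hY, _⟩
    rw [hY, hY, effect]

end Model

section Realization

variable {m : ℕ} {γ : Fin (m + 1) → ℝ}

theorem exists_isIVModel_of_obs_eq {ν : Measure (Latent m)} {ρ : Measure (Fin 2)}
    [IsFiniteMeasure ν] [IsProbabilityMeasure ρ] (hρ : ∀ z, ρ {z} ≠ 0) {q : Latent m → ℝ}
    (hq : q ∈ stdSimplex ℝ (Latent m)) (hobs : obs q = obs fun k => ν.real {k}) :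
    ∃ (Ω : Type) (_ : MeasurableSpace Ω) (μ : Measure Ω) (X : IVData Ω),
      IsIVModel γ μ X ∧ X.observedLaw μ = observableLaw γ ν ρ ∧
        X.ATE μ = averageEffect γ q := by
  obtain ⟨ν', _, rfl⟩ := exists_isProbabilityMeasure_real_singleton_eq hq
  exact ⟨Latent m × Fin 2, _, ν'.prod ρ, canonicalData γ, isIVModel_canonicalData γ hρ,
    (observedLaw_canonicalData γ ν' ρ).trans (observableLaw_congr hobs), ATE_canonicalData γ⟩

theorem exists_isIVModel_condVec_eq_obs (hγ : Function.Injective γ) {q : Latent m → ℝ}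
    (hq : q ∈ stdSimplex ℝ (Latent m)) :
    ∃ (Ω : Type) (_ : MeasurableSpace Ω) (μ : Measure Ω) (X : IVData Ω),
      IsIVModel γ μ X ∧ condVec γ (X.observedLaw μ) = obs q ∧
        condVec γ (conjugateLaw (X.observedLaw μ)) = obs (q ∘ swapTreatment) := by
  obtain ⟨ν, _, rfl⟩ := exists_isProbabilityMeasure_real_singleton_eq hq
  have hρ (z : Fin 2) : uniformOn Set.univ {z} ≠ 0 := by
    simp [uniformOn_univ]
  refine ⟨Latent m × Fin 2, _, ν.prod (uniformOn Set.univ), canonicalData γ,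
    isIVModel_canonicalData γ hρ, ?_, ?_⟩
  · rw [observedLaw_canonicalData, condVec_observableLaw hγ hρ]
  · rw [observedLaw_canonicalData, condVec_conjugateLaw_observableLaw hγ hρ]

end Realization

theorem mainTheorem2 {m : ℕ} (γ : Fin (m + 1) → ℝ) (hγ : StrictMono γ) :
    -- validity and sharpness of both bounds, at every law conforming to the model
    (∀ (Ω : Type*) [MeasurableSpace Ω] (μ : Measure Ω) (X : IVData Ω), IsIVModel γ μ X →
      (vertexMax γ (condVec γ (X.observedLaw μ)) ≤ X.ATE μ ∧
        X.ATE μ ≤ -vertexMax γ (condVec γ (conjugateLaw (X.observedLaw μ)))) ∧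
      (∃ (Ω' : Type) (_ : MeasurableSpace Ω') (μ' : Measure Ω') (X' : IVData Ω'),
        IsIVModel γ μ' X' ∧ X'.observedLaw μ' = X.observedLaw μ ∧
        X'.ATE μ' = vertexMax γ (condVec γ (X.observedLaw μ))) ∧
      (∃ (Ω' : Type) (_ : MeasurableSpace Ω') (μ' : Measure Ω') (X' : IVData Ω'),
        IsIVModel γ μ' X' ∧ X'.observedLaw μ' = X.observedLaw μ ∧
        X'.ATE μ' = -vertexMax γ (condVec γ (conjugateLaw (X.observedLaw μ))))) ∧
    -- no term can be dropped, neither from the lower nor from the upper bound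
    (∀ v ∈ vertexSet γ,
      (∃ (Ω : Type) (_ : MeasurableSpace Ω) (μ : Measure Ω) (X : IVData Ω),
        IsIVModel γ μ X ∧ ∀ w ∈ vertexSet γ, w ≠ v →
          pairing w (condVec γ (X.observedLaw μ)) < pairing v (condVec γ (X.observedLaw μ))) ∧
      (∃ (Ω : Type) (_ : MeasurableSpace Ω) (μ : Measure Ω) (X : IVData Ω),
        IsIVModel γ μ X ∧ ∀ w ∈ vertexSet γ, w ≠ v →
          pairing w (condVec γ (conjugateLaw (X.observedLaw μ))) <
            pairing v (condVec γ (conjugateLaw (X.observedLaw μ))))) := by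
  refine ⟨fun Ω _ μ X hX => ?_, fun v hv => ?_⟩
  · obtain ⟨ν, ρ, _, _, hρ, hlaw, hATE⟩ := hX.exists_observedLaw_eq_and_ATE_eq hγ.injective
    have hν := real_singleton_mem_stdSimplex ν
    rw [hlaw, hATE, condVec_observableLaw hγ.injective hρ,
      condVec_conjugateLaw_observableLaw hγ.injective hρ]
    refine ⟨⟨vertexMax_obs_le_averageEffect hγ.monotone hν.1,
      averageEffect_le_neg_vertexMax hγ.monotone hν.1⟩, ?_, ?_⟩
    · obtain ⟨q, hq, hobs, heffect⟩ := exists_obs_eq_and_averageEffect_eq_vertexMax hγ hν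
      rw [← heffect]
      exact exists_isIVModel_of_obs_eq hρ hq hobs
    · obtain ⟨q, hq, hobs, heffect⟩ := exists_obs_eq_and_averageEffect_eq_neg_vertexMax hγ hν
      rw [← heffect]
      exact exists_isIVModel_of_obs_eq hρ hq hobs
  · obtain ⟨q, hq, hlt⟩ := exists_forall_pairing_obs_lt hγ.monotone hv
    constructor
    · obtain ⟨Ω, _, μ, X, hX, hcond, -⟩ := exists_isIVModel_condVec_eq_obs hγ.injective hq
      exact ⟨Ω, _, μ, X, hX, hcond ▸ hlt⟩
    · obtain ⟨Ω, _, μ, X, hX, -, hcond⟩ := exists_isIVModel_condVec_eq_obs hγ.injective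
        (comp_swapTreatment_mem_stdSimplex hq)
      rw [comp_swapTreatment_comp_swapTreatment] at hcond
      exact ⟨Ω, _, μ, X, hX, hcond ▸ hlt⟩
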